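/- Let $X$ be a $\sigma$-compact metric space with its Borel $\sigma$-algebra, and let $\sigma$ be a $\sigma$-finite diffuse Borel measure on $X$ (i.e. $\sigma(\{x\})=0$ for all $x\in X$) which is finite on compact sets. Let $\Omega^X$ be the space of at most countable, locally finite subsets $\omega$ of $X$, each identified with the point measure $\omega=\sum_{x\in\omega}\epsilon_x$ ($\epsilon_x$ the Dirac measure at $x$), with the $\sigma$-algebra generated by the maps $\omega\mapsto\omega(A)$, $A\subset X$ Borel. Let $\pi_\sigma$ be the Poisson probability measure on $\Omega^X$ with intensity $\sigma$: for all pairwise disjoint compact sets $A_1,\dots,A_m\subset X$, the counts $\omega(A_1),\dots,\omega(A_m)$ are independent Poisson random variables with parameters $\sigma(A_1),\dots,\sigma(A_m)$. Write $E$ for the expectation under $\pi_\sigma$. For $a\ge 0$, $\mathfrak s_a=(s_1,\dots,s_a)\in X^a$ and $G:\Omega^X\to\mathbb R$, put $(\varepsilon^+_{\mathfrak s_a}G)(\omega)=G(\omega\cup\{s_1,\dots,s_a\})$, and write $d\sigma^a(\mathfrak s_a)=\sigma(ds_1)\cdots\sigma(ds_a)$. Let $F:\Omega^X\to\mathbb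 R$ be a bounded random variable and let $u:\Omega^X\times X\to\mathbb R$, $(\omega,x)\mapsto u_x(\omega)$, be a bounded (jointly measurable) process with compact support in $X$: there is a compact $K\subset X$ such that $u_x(\omega)=0$ for all $\omega\in\Omega^X$ and $x\in X\setminus K$. Then for all $n\ge 0$, all the integrals below are absolutely convergent and $$ E\left[F\left(\int_X u_x(\omega)\,(\omega(dx)-\sigma(dx))\right)^n\right] =\sum_{c=0}^n(-1)^c\binom nc\sum_{P_1,\dots,P_a} E\left[\int_{X^a}\varepsilon^+_{\mathfrak s_a}\left(F\left(\int_X u_x(\omega)\,\sigma(dx)\right)^c u_{s_1}^{|P_1|}\cdots u_{s_a}^{|P_a|}\right)d\sigma^a(\mathfrak s_a)\right], $$ where, for each $c$, the inner sum runs over all (unordered) partitions $P_1\cup\dots\cup P_a=\{1,\dots,n-c\}$ into $a\geq 0$ disjoint nonempty blocks (for $c=n$: only the empty partition, with $a=0$), $|P_i|$ denotes the cardinality of $P_i$, and $0^0=1$. -/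

import Mathlib

open MeasureTheory ProbabilityTheory
open scoped ENNReal NNReal

/-- The configuration space `Ω^X`: at most countable, locally finite subsets of `X`
(finitely many points in every compact set). -/
structure Config (X : Type*) [TopologicalSpace X] where
  carrier : Set X
  countable : carrier.Countable
  locallyFinite : ∀ K : Set X, IsCompact K → (carrier ∩ K).Finite

namespace Config

section
variable {X : Type*} [TopologicalSpace X]

/-- The configuration `ω ∪ {s_i : i ∈ ι}`, for a finite family of points `s`. -/
def addPoints {ι : Type*} [Finite ι] (ω : Config X) (s : ι → X) : Config X where
  carrier := ω.carrier ∪ Set.range s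
  countable := ω.countable.union (Set.finite_range s).countable
  locallyFinite K hK := by
    rw [Set.union_inter_distrib_right]
    exact (ω.locallyFinite K hK).union ((Set.finite_range s).subset Set.inter_subset_left)

/-- The addition operator `ε⁺_s`: `(ε⁺_s G)(ω) = G(ω ∪ {s_i : i ∈ ι})`. -/
def epsPlus {ι : Type*} [Finite ι] (s : ι → X) (G : Config X → ℝ) : Config X → ℝ :=
  fun ω => G (ω.addPoints s)

/-- The point measure `∑_{x ∈ ω} δ_x` with which the configuration `ω` is identified. -/
noncomputable def toMeasure [MeasurableSpace X] (ω : Config X) : Measure X :=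
  Measure.sum fun x : ω.carrier => Measure.dirac (x : X)

/-- The `σ`-algebra on the configuration space generated by the counting maps `ω ↦ ω(A)`,
`A ⊆ X` measurable. -/
noncomputable instance instMeasurableSpace [MeasurableSpace X] : MeasurableSpace (Config X) :=
  MeasurableSpace.comap toMeasure inferInstance

/-- `π` is the law `π_σ` of the Poisson process with intensity `σ` (a measure finite on compact
sets): for pairwise disjoint compact sets `A_1, …, A_m`, the counts `ω(A_1), …, ω(A_m)` are
independent Poisson variables with parameters `σ(A_1), …, σ(A_m)`. The counts are regarded as
`[0, ∞]`-valued, so the Poisson law on `ℕ` is pushed forward along `ℕ → [0, ∞]`. -/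
def IsPoisson [MeasurableSpace X] (σ : Measure X) (π : Measure (Config X)) : Prop :=
  ∀ (m : ℕ) (A : Fin m → Set X), (∀ i, IsCompact (A i)) →
    Pairwise (fun i j => Disjoint (A i) (A j)) →
      iIndepFun (fun (i : Fin m) (ω : Config X) => ω.toMeasure (A i)) π ∧
      ∀ i, π.map (fun ω => ω.toMeasure (A i)) =
        (poissonMeasure (σ (A i)).toNNReal).map (fun k : ℕ => (k : ℝ≥0∞))

end

end Config

/-! Expand the `n`-th power by the binomial theorem. The compensator `∫ u dσ` depends on `ω` but is
bounded, because `u` is bounded and vanishes off a compact `K`. Hence every term has the form `E[G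
(∫ u dω)^k]` with the bounded weight `G = F (∫ u dσ)^c` and `k = n - c`.

The power `(∫ u dω)^k` is a finite sum of `u(x₁)⋯u(x_k)` over `k`-tuples of points of `ω ∩ K`.
Grouping the tuples by the coincidences among their entries produces a partition of the indices
together with distinct points, one for each block; a block of size `m` contributes `u^m`
(`Finpartition.sum_piFinset_eq`, `Finpartition.prod_blockOf`). The multivariate Mecke formula
`lintegral_pi_injective` then turns a sum over distinct points of `ω` into an integral against
`σ^a`, with these points added to the configuration. The two facts combine into an identity of
measures, `compProd_powKernel`. Its right side is a finite measure, which gives absolute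
convergence.

Mecke's formula goes back to the recursion `(n+1) p(n+1) = r p(n)` of the Poisson weights. It is
proved for functions of the counts of disjoint sets, extended to all events by a π-system argument,
and extended to several points by induction. Configurations carry no multiplicities, so diffuseness
of `σ` is essential: an added point is almost surely new. The laws of the counts, given on compact
sets only, are extended beforehand to Borel subsets of compact sets (`measure_forall_eq`). -/

/-- A kernel all of whose measures are finite is s-finite. -/
theorem ProbabilityTheory.Kernel.isSFiniteKernel_of_isFiniteMeasure {α β : Type*}
    [MeasurableSpace α] [MeasurableSpace β] (κ : Kernel α β) (h : ∀ a, IsFiniteMeasure (κ a)) :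
    IsSFiniteKernel κ := by
  classical
  have hm : Measurable fun a => ⌊(κ a Set.univ).toNNReal⌋₊ :=
    Nat.measurable_floor.comp (κ.measurable_coe MeasurableSet.univ).ennreal_toNNReal
  have hs : ∀ m : ℕ, MeasurableSet {a | ⌊(κ a Set.univ).toNNReal⌋₊ = m} := fun m =>
    hm (measurableSet_singleton m)
  -- Split the parameter space by the integer part `m` of the total mass; on each piece the mass is
  -- at most `m + 1`.
  have key : κ = Kernel.sum fun m => Kernel.piecewise (hs m) κ 0 := by
    ext a t ht
    rw [Kernel.sum_apply' _ _ ht, tsum_eq_single ⌊(κ a Set.univ).toNNReal⌋₊]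
    · rw [Kernel.piecewise_apply, if_pos (by simp)]
    · intro m hm
      rw [Kernel.piecewise_apply, if_neg (fun h => hm h.symm)]
      simp
  rw [key]
  have : ∀ m, IsFiniteKernel (Kernel.piecewise (hs m) κ 0) := by
    intro m
    refine ⟨⟨(m : ℝ≥0∞) + 1, by simp, fun a => ?_⟩⟩
    rw [Kernel.piecewise_apply]
    split_ifs with ha
    · have h1 := Nat.lt_floor_add_one (κ a Set.univ).toNNReal
      rw [show ⌊(κ a Set.univ).toNNReal⌋₊ = m from ha] at h1
      rw [← ENNReal.coe_toNNReal (measure_ne_top (κ a) Set.univ)]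
      exact_mod_cast h1.le
    · simp
  infer_instance

/-! ### Adding points to configurations, and their point measures -/

namespace Config

section Basic
variable {X : Type*} [TopologicalSpace X]

theorem ext_carrier {ω ω' : Config X} (h : ω.carrier = ω'.carrier) : ω = ω' := by
  cases ω; cases ω'; cases h; rfl

theorem addPoints_comp_equiv {ι ι' : Type*} [Finite ι] [Finite ι'] (e : ι' ≃ ι) (ω : Config X)
    (s : ι → X) : ω.addPoints (s ∘ e) = ω.addPoints s :=
  ext_carrier (by simp [addPoints, EquivLike.range_comp])

theorem addPoints_of_isEmpty {ι : Type*} [Finite ι] [IsEmpty ι] (ω : Config X) (s : ι → X) :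
    ω.addPoints s = ω :=
  ext_carrier (by simp [addPoints, Set.range_eq_empty])

/-- The configuration `ω ∪ {x}`. -/
def addPoint (ω : Config X) (x : X) : Config X := ω.addPoints fun _ : Unit => x

theorem carrier_addPoint (ω : Config X) (x : X) :
    (ω.addPoint x).carrier = ω.carrier ∪ {x} := by
  simp [addPoint, addPoints]

theorem addPoint_of_mem {ω : Config X} {x : X} (h : x ∈ ω.carrier) : ω.addPoint x = ω :=
  ext_carrier (by simpa [carrier_addPoint] using h)

theorem addPoints_cons {n : ℕ} (ω : Config X) (x : X) (s : Fin n → X) :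
    ω.addPoints (Fin.cons x s : Fin (n + 1) → X) = (ω.addPoints s).addPoint x :=
  ext_carrier (by
    rw [carrier_addPoint]
    simp [addPoints, Fin.range_cons, Set.union_insert])

theorem addPoint_addPoints {ι : Type*} [Finite ι] (ω : Config X) (x : X) (s : ι → X) :
    (ω.addPoint x).addPoints s = (ω.addPoints s).addPoint x :=
  ext_carrier (by
    rw [carrier_addPoint]
    simp [addPoints, addPoint, Set.insert_union])

variable [MeasurableSpace X]

theorem measurable_toMeasure : Measurable (toMeasure : Config X → Measure X) :=
  comap_measurable _

theorem measurable_toMeasure_apply {A : Set X} (hA : MeasurableSet A) :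
    Measurable fun ω : Config X => ω.toMeasure A :=
  (Measure.measurable_coe hA).comp measurable_toMeasure

theorem measurable_of_toMeasure {α : Type*} [MeasurableSpace α] {f : α → Config X}
    (h : Measurable fun a => (f a).toMeasure) : Measurable f :=
  measurable_comap_iff.2 h

theorem toMeasure_apply (ω : Config X) {A : Set X} (hA : MeasurableSet A) :
    ω.toMeasure A = ((ω.carrier ∩ A).encard : ℝ≥0∞) := by
  rw [toMeasure, Measure.sum_apply _ hA, ← ENNReal.tsum_set_one, 
    tsum_subtype ω.carrier (fun x => Measure.dirac x A),
    tsum_subtype (ω.carrier ∩ A) (fun _ => (1 : ℝ≥0∞))]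
  refine tsum_congr fun x => ?_
  rw [← Set.indicator_indicator]
  simp only [Measure.dirac_apply' _ hA]
  rfl

theorem toMeasure_eq_zero_iff (ω : Config X) {A : Set X} (hA : MeasurableSet A) :
    ω.toMeasure A = 0 ↔ ω.carrier ∩ A = ∅ := by
  rw [toMeasure_apply ω hA]; simp

theorem toMeasure_addPoint [MeasurableSingletonClass X] {ω : Config X} {x : X}
    (h : x ∉ ω.carrier) : (ω.addPoint x).toMeasure = ω.toMeasure + Measure.dirac x := by
  ext A hA
  rw [Measure.add_apply, toMeasure_apply _ hA, toMeasure_apply _ hA, carrier_addPoint,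
    Set.union_inter_distrib_right, Set.encard_union_eq, Measure.dirac_apply' _ hA]
  · by_cases hx : x ∈ A
    · simp [hx, Set.inter_eq_left.2]
    · simp [hx, Set.singleton_inter_eq_empty.2]
  · exact (Set.disjoint_singleton_right.2 h).mono Set.inter_subset_left Set.inter_subset_left

end Basic

/-! ### Local finiteness and measurability in a σ-compact metric space -/

section Metric
variable {X : Type*} [MetricSpace X]

/-- A convergent sequence together with its limit is compact, so it meets the configuration in a
finite, hence closed, set. -/
theorem isClosed_carrier (ω : Config X) : IsClosed ω.carrier := by
  refine IsSeqClosed.isClosed fun s x hs hx => ?_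
  have hf := ω.locallyFinite _ hx.isCompact_insert_range
  have := hf.isClosed.isSeqClosed (x := s) (p := x) (fun n => ⟨hs n, by simp⟩) hx
  exact this.1

/-- The finite set of points of a configuration that lie in a compact set. -/
noncomputable def pointsIn (ω : Config X) {K : Set X} (hK : IsCompact K) : Finset X :=
  (ω.locallyFinite K hK).toFinset

theorem mem_pointsIn {ω : Config X} {K : Set X} {hK : IsCompact K} {x : X} :
    x ∈ ω.pointsIn hK ↔ x ∈ ω.carrier ∧ x ∈ K := by
  simp [pointsIn]

variable [MeasurableSpace X]

theorem exists_nat_toMeasure_eq (ω : Config X) {K A : Set X} (hK : IsCompact K) (hAK : A ⊆ K)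
    (hA : MeasurableSet A) : ∃ n : ℕ, ω.toMeasure A = n := by
  have hf : (ω.carrier ∩ A).Finite :=
    (ω.locallyFinite K hK).subset (Set.inter_subset_inter_right _ hAK)
  refine ⟨hf.toFinset.card, ?_⟩
  rw [toMeasure_apply ω hA, hf.encard_eq_coe_toFinset_card]
  simp

variable [BorelSpace X]

theorem toMeasure_lt_top (ω : Config X) {K : Set X} (hK : IsCompact K) : ω.toMeasure K < ∞ := by
  obtain ⟨n, hn⟩ := ω.exists_nat_toMeasure_eq hK subset_rfl hK.measurableSet
  rw [hn]; exact ENNReal.natCast_lt_top n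

theorem isFiniteMeasure_restrict (ω : Config X) {K : Set X} (hK : IsCompact K) :
    IsFiniteMeasure (ω.toMeasure.restrict K) :=
  ⟨by simpa using ω.toMeasure_lt_top hK⟩

theorem restrict_toMeasure (ω : Config X) {K : Set X} (hK : IsCompact K) :
    ω.toMeasure.restrict K = ∑ x ∈ ω.pointsIn hK, Measure.dirac x := by
  classical
  ext A hA
  rw [Measure.restrict_apply hA, toMeasure_apply _ (hA.inter hK.measurableSet),
    Measure.finsetSum_apply]
  simp only [Measure.dirac_apply' _ hA]
  rw [Finset.sum_indicator_eq_sum_filter]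
  have : ω.carrier ∩ (A ∩ K) = ((ω.pointsIn hK).filter (· ∈ A) : Finset X) := by
    ext x; simp [mem_pointsIn]; tauto
  rw [this, Set.encard_coe_eq_coe_finsetCard]
  simp

/-- The kernel `ω ↦ ω|_K`, for a compact set `K`. -/
noncomputable def restrictKernel {K : Set X} (hK : IsCompact K) : Kernel (Config X) X :=
  Kernel.restrict ⟨toMeasure, measurable_toMeasure⟩ hK.measurableSet

theorem restrictKernel_apply {K : Set X} (hK : IsCompact K) (ω : Config X) :
    restrictKernel hK ω = ω.toMeasure.restrict K := rfl

instance {K : Set X} (hK : IsCompact K) : IsSFiniteKernel (restrictKernel (X := X) hK) :=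
  Kernel.isSFiniteKernel_of_isFiniteMeasure _ fun ω => ω.isFiniteMeasure_restrict hK

variable [SigmaCompactSpace X]

/-- Since `ω` is closed, `x ∈ ω` means that at every scale `1/(n+1)` some ball around a point of a
dense sequence contains `x` and meets `ω`. This is a countable combination of counting events and
balls. -/
theorem measurableSet_mem_carrier :
    MeasurableSet {p : Config X × X | p.2 ∈ p.1.carrier} := by
  have : SecondCountableTopology X := EMetric.secondCountable_of_sigmaCompact X
  rcases isEmpty_or_nonempty X with hX | hX
  · convert MeasurableSet.empty
    ext p; exact hX.elim p.2
  have key : {p : Config X × X | p.2 ∈ p.1.carrier} =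
      ⋂ n : ℕ, ⋃ i : ℕ, {ω : Config X |
        ω.toMeasure (Metric.ball (TopologicalSpace.denseSeq X i) (1 / ((n : ℝ) + 1))) ≠ 0} ×ˢ
        Metric.ball (TopologicalSpace.denseSeq X i) (1 / ((n : ℝ) + 1)) := by
    ext ⟨ω, x⟩
    simp only [Set.mem_ofPred_eq, Set.mem_iInter, Set.mem_iUnion, Set.mem_prod]
    constructor
    · intro hx n
      obtain ⟨i, hi⟩ := (TopologicalSpace.denseRange_denseSeq X).exists_mem_open
        (Metric.isOpen_ball (x := x) (ε := 1 / ((n : ℝ) + 1)))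
        ⟨x, Metric.mem_ball_self Nat.one_div_pos_of_nat⟩
      refine ⟨i, ?_, Metric.mem_ball_comm.1 hi⟩
      rw [Ne, toMeasure_eq_zero_iff _ measurableSet_ball]
      exact Set.Nonempty.ne_empty ⟨x, hx, Metric.mem_ball_comm.1 hi⟩
    · intro h
      rw [← ω.isClosed_carrier.closure_eq, Metric.mem_closure_iff]
      intro ε hε
      obtain ⟨n, hn⟩ := exists_nat_one_div_lt (half_pos hε)
      obtain ⟨i, hi, hxi⟩ := h n
      rw [Ne, toMeasure_eq_zero_iff _ measurableSet_ball] at hi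
      obtain ⟨y, hy, hyi⟩ := Set.nonempty_iff_ne_empty.2 hi
      refine ⟨y, hy, ?_⟩
      have h1 := Metric.mem_ball.1 hxi
      have h2 := Metric.mem_ball'.1 hyi
      linarith [dist_triangle x (TopologicalSpace.denseSeq X i) y]
  rw [key]
  refine MeasurableSet.iInter fun n => MeasurableSet.iUnion fun i => MeasurableSet.prod ?_
    measurableSet_ball
  exact (measurable_toMeasure_apply measurableSet_ball) (measurableSet_singleton 0).compl

/-- Adding a point increases the point measure only if the point is new, so the map is defined
piecewise along the measurable set `x ∈ ω`. -/
theorem measurable_addPoint : Measurable fun p : Config X × X => p.1.addPoint p.2 := by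
  classical
  refine measurable_of_toMeasure ?_
  have : (fun p : Config X × X => (p.1.addPoint p.2).toMeasure) = fun p =>
      if p ∈ {p : Config X × X | p.2 ∈ p.1.carrier} then p.1.toMeasure
      else p.1.toMeasure + Measure.dirac p.2 := by
    ext1 p
    split_ifs with h
    · rw [addPoint_of_mem h]
    · rw [toMeasure_addPoint h]
  rw [this]
  refine Measurable.ite measurableSet_mem_carrier (measurable_toMeasure.comp measurable_fst) ?_
  refine Measure.measurable_of_measurable_coe _ fun A hA => ?_
  simp only [Measure.add_apply]
  exact ((measurable_toMeasure_apply hA).comp measurable_fst).add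
    ((Measure.measurable_coe hA).comp (Measure.measurable_dirac.comp measurable_snd))

theorem measurable_addPoints_fin (n : ℕ) :
    Measurable fun p : Config X × (Fin n → X) => p.1.addPoints p.2 := by
  induction n with
  | zero => simpa only [addPoints_of_isEmpty] using measurable_fst
  | succ n ih =>
    have : (fun p : Config X × (Fin (n + 1) → X) => p.1.addPoints p.2) =
        fun p => (p.1.addPoints (Fin.tail p.2)).addPoint (p.2 0) := by
      ext1 p
      rw [← addPoints_cons, Fin.cons_self_tail]
    rw [this]
    have h1 : Measurable fun p : Config X × (Fin (n + 1) → X) => (p.1, Fin.tail p.2) :=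
      measurable_fst.prodMk (measurable_pi_lambda _ fun i =>
        (measurable_pi_apply i.succ).comp measurable_snd)
    exact measurable_addPoint.comp ((ih.comp h1).prodMk
      ((measurable_pi_apply 0).comp measurable_snd))

theorem measurable_addPoints {ι : Type*} [Finite ι] :
    Measurable fun p : Config X × (ι → X) => p.1.addPoints p.2 := by
  obtain ⟨n, ⟨e⟩⟩ := Finite.exists_equiv_fin ι
  have : (fun p : Config X × (ι → X) => p.1.addPoints p.2) =
      fun p => p.1.addPoints (p.2 ∘ e.symm) := by
    ext1 p; rw [addPoints_comp_equiv]
  rw [this]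
  have h1 : Measurable fun p : Config X × (ι → X) => (p.1, p.2 ∘ e.symm) :=
    measurable_fst.prodMk (measurable_pi_lambda _ fun i =>
      (measurable_pi_apply (e.symm i)).comp measurable_snd)
  exact (measurable_addPoints_fin n).comp h1

/-- The kernel `ω ↦ (ω|_K)^{⊗ι}`, for a compact set `K`. -/
noncomputable def powKernel {K : Set X} (hK : IsCompact K) (ι : Type*) [Fintype ι] :
    Kernel (Config X) (ι → X) where
  toFun ω := Measure.pi fun _ => ω.toMeasure.restrict K
  measurable' := by
    have : ∀ ω : Config X, IsFiniteMeasure (ω.toMeasure.restrict K) := fun ω =>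
      ω.isFiniteMeasure_restrict hK
    refine Measurable.measure_of_isPiSystem generateFrom_pi.symm isPiSystem_pi ?_ ?_
    · rintro _ ⟨A, hA, rfl⟩
      simp only [Measure.pi_pi]
      refine Finset.measurable_prod _ fun i _ => ?_
      have hAi : MeasurableSet (A i) := hA i (Set.mem_univ i)
      simp only [Measure.restrict_apply hAi]
      exact measurable_toMeasure_apply (hAi.inter hK.measurableSet)
    · simp only [Measure.pi_univ, Measure.restrict_apply MeasurableSet.univ]
      exact Finset.measurable_prod _ fun i _ =>
        measurable_toMeasure_apply (MeasurableSet.univ.inter hK.measurableSet)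

theorem powKernel_apply {K : Set X} (hK : IsCompact K) (ι : Type*) [Fintype ι] (ω : Config X) :
    powKernel hK ι ω = Measure.pi fun _ => ω.toMeasure.restrict K := rfl

instance {K : Set X} (hK : IsCompact K) (ι : Type*) [Fintype ι] :
    IsSFiniteKernel (powKernel (X := X) hK ι) :=
  Kernel.isSFiniteKernel_of_isFiniteMeasure _ fun ω => by
    have := ω.isFiniteMeasure_restrict hK
    rw [powKernel_apply]; infer_instance

end Metric

end Config

/-! ### Recursion for the Poisson weights -/

section Poisson

theorem poissonMeasure_singleton_succ_mul (r : ℝ≥0) (n : ℕ) :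
    ((n + 1 : ℕ) : ℝ≥0∞) * poissonMeasure r {n + 1} = r * poissonMeasure r {n} := by
  rw [poissonMeasure_singleton, poissonMeasure_singleton, ← ENNReal.ofReal_natCast,
    ← ENNReal.ofReal_coe_nnreal, ← ENNReal.ofReal_mul (by positivity),
    ← ENNReal.ofReal_mul (by positivity), Nat.factorial_succ]
  congr 1
  push_cast
  have : ((n.factorial : ℕ) : ℝ) ≠ 0 := by positivity
  field_simp
  ring

/-- The Chen-Stein identity for a vector of independent Poisson variables. -/
theorem lintegral_pi_poissonMeasure_mul {ι : Type*} [Fintype ι] [DecidableEq ι] (r : ι → ℝ≥0)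
    (f : (ι → ℕ) → ℝ≥0∞) (b : ι) :
    ∫⁻ n, (n b : ℝ≥0∞) * f n ∂(Measure.pi fun i => poissonMeasure (r i)) =
      r b * ∫⁻ n, f (n + Pi.single b 1) ∂(Measure.pi fun i => poissonMeasure (r i)) := by
  rw [lintegral_countable', lintegral_countable', ← ENNReal.tsum_mul_left]
  have hinj : Function.Injective fun n : ι → ℕ => n + Pi.single b 1 := add_left_injective _
  -- Terms with `n b = 0` vanish because of the factor `n b`, so the sum may be taken over the image
  -- of the shift.
  rw [← hinj.tsum_eq]
  · refine tsum_congr fun n => ?_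
    rw [Measure.pi_singleton, Measure.pi_singleton,
      ← Finset.mul_prod_erase _ _ (Finset.mem_univ b),
      ← Finset.mul_prod_erase _ _ (Finset.mem_univ b)]
    have h1 : ∏ x ∈ Finset.univ.erase b, poissonMeasure (r x) {(n + Pi.single b 1 : ι → ℕ) x} =
        ∏ x ∈ Finset.univ.erase b, poissonMeasure (r x) {n x} :=
      Finset.prod_congr rfl fun x hx => by
        simp [Pi.single_eq_of_ne (Finset.ne_of_mem_erase hx)]
    rw [h1]
    have h2 := poissonMeasure_singleton_succ_mul (r b) (n b)
    simp only [Pi.add_apply, Pi.single_eq_same]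
    calc _ = f (n + Pi.single b 1) * (((n b + 1 : ℕ) : ℝ≥0∞) * poissonMeasure (r b) {n b + 1}) *
          ∏ x ∈ Finset.univ.erase b, poissonMeasure (r x) {n x} := by ring
      _ = _ := by rw [h2]; ring
  · intro n hn
    have hb : n b ≠ 0 := by
      rintro h
      simp [h] at hn
    refine ⟨n - Pi.single b 1, ?_⟩
    funext i
    by_cases hi : i = b
    · subst hi; simp; omega
    · simp [Pi.single_eq_of_ne hi]

theorem lintegral_natCast_poissonMeasure (r : ℝ≥0) :
    ∫⁻ n : ℕ, (n : ℝ≥0∞) ∂(poissonMeasure r) = r := by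
  rw [lintegral_countable', tsum_eq_zero_add' ENNReal.summable]
  simp_rw [poissonMeasure_singleton_succ_mul]
  rw [ENNReal.tsum_mul_left]
  have := lintegral_countable' (μ := poissonMeasure r) (fun _ => 1)
  simp only [lintegral_const, measure_univ, one_mul] at this
  rw [← this]; simp

end Poisson

/-! ### Joint law of the counts on Borel subsets of a compact set -/

namespace Config

variable {X : Type*} [MetricSpace X]

/-- The number of points of a configuration in a set. -/
noncomputable def count (ω : Config X) (A : Set X) : ℕ := (ω.carrier ∩ A).ncard

variable [MeasurableSpace X]

theorem coe_count (ω : Config X) {K A : Set X} (hK : IsCompact K) (hAK : A ⊆ K)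
    (hA : MeasurableSet A) : (ω.count A : ℝ≥0∞) = ω.toMeasure A := by
  have hf : (ω.carrier ∩ A).Finite :=
    (ω.locallyFinite K hK).subset (Set.inter_subset_inter_right _ hAK)
  rw [toMeasure_apply ω hA, count, ← hf.cast_ncard_eq]
  simp

theorem count_eq_iff (ω : Config X) {K A : Set X} (hK : IsCompact K) (hAK : A ⊆ K)
    (hA : MeasurableSet A) (n : ℕ) : ω.count A = n ↔ ω.toMeasure A = n := by
  rw [← ω.coe_count hK hAK hA, Nat.cast_inj]

theorem measurable_count {K A : Set X} (hK : IsCompact K) (hAK : A ⊆ K)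
    (hA : MeasurableSet A) : Measurable fun ω : Config X => ω.count A := by
  refine measurable_to_countable' fun n => ?_
  simp only [Set.preimage, Set.mem_singleton_iff, count_eq_iff _ hK hAK hA]
  exact measurable_toMeasure_apply hA (measurableSet_singleton _)

variable [BorelSpace X]

namespace IsPoisson

variable {σ : Measure X} {π : Measure (Config X)}

theorem measure_forall_eq_of_isCompact (hπ : IsPoisson σ π) {ι : Type*} [Fintype ι]
    {A : ι → Set X} (hA : ∀ i, IsCompact (A i)) (hd : Pairwise fun i j => Disjoint (A i) (A j))
    (n : ι → ℕ) :
    π {ω | ∀ i, ω.toMeasure (A i) = n i} = ∏ i, poissonMeasure (σ (A i)).toNNReal {n i} := by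
  let e := (Fintype.equivFin ι).symm
  obtain ⟨h1, h2⟩ := hπ _ (fun i => A (e i)) (fun i => hA _)
    (fun i j hij => hd (e.injective.ne hij))
  have h3 := h1.measure_inter_preimage_eq_mul Finset.univ (sets := fun i => {(n (e i) : ℝ≥0∞)})
    (fun i _ => measurableSet_singleton _)
  have h4 : ∀ i, π ((fun ω : Config X => ω.toMeasure (A (e i))) ⁻¹' {(n (e i) : ℝ≥0∞)}) =
      poissonMeasure (σ (A (e i))).toNNReal {n (e i)} := by
    intro i
    have h5 := congrArg (fun μ => μ {(n (e i) : ℝ≥0∞)}) (h2 i)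
    beta_reduce at h5
    rw [Measure.map_apply (measurable_toMeasure_apply (hA _).measurableSet)
      (measurableSet_singleton _), Measure.map_apply (measurable_of_countable _)
      (measurableSet_singleton _)] at h5
    rw [h5]
    congr 1
    ext k; simp
  simp only [h4] at h3
  rw [e.prod_comp (fun i => poissonMeasure (σ (A i)).toNNReal {n i})] at h3
  rw [← h3]
  congr 1
  ext ω
  simp only [Finset.mem_univ, Set.iInter_true, Set.mem_iInter, Set.mem_preimage,
    Set.mem_singleton_iff, Set.mem_ofPred_eq]
  exact (e.forall_congr_right (q := fun i => ω.toMeasure (A i) = n i)).symm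

variable [IsFiniteMeasureOnCompacts σ]

theorem lintegral_toMeasure_of_isCompact (hπ : IsPoisson σ π) {A : Set X} (hA : IsCompact A) :
    ∫⁻ ω, ω.toMeasure A ∂π = σ A := by
  have h := (hπ 1 (fun _ => A) (fun _ => hA) (fun i j hij => (hij (Subsingleton.elim _ _)).elim)).2 0
  calc ∫⁻ ω, ω.toMeasure A ∂π = ∫⁻ t, t ∂(π.map fun ω => ω.toMeasure A) :=
        (lintegral_map measurable_id (measurable_toMeasure_apply hA.measurableSet)).symm
    _ = σ A := by
        rw [h, lintegral_map (f := fun t => t) measurable_id (measurable_of_countable _),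
          lintegral_natCast_poissonMeasure, ENNReal.coe_toNNReal hA.measure_lt_top.ne]

variable [SigmaCompactSpace X]

/-- Both sides are measures in `A` that agree on compact sets. These form a π-system, which
generates the Borel sets because closed sets are countable unions of compact ones. -/
theorem lintegral_toMeasure (hπ : IsPoisson σ π) {A : Set X} (hA : MeasurableSet A) :
    ∫⁻ ω, ω.toMeasure A ∂π = σ A := by
  have hb : ∀ {A : Set X}, MeasurableSet A →
      π.bind toMeasure A = ∫⁻ ω, ω.toMeasure A ∂π := fun hA =>
    Measure.bind_apply hA measurable_toMeasure.aemeasurable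
  rw [← hb hA]
  congr 1
  refine Measure.ext_of_generateFrom_of_iUnion {K | IsCompact K} (compactCovering X) ?_ ?_
    (iUnion_compactCovering X) (fun i => isCompact_compactCovering X i) (fun i => ?_)
    fun K hK => ?_
  · apply le_antisymm
    · rw [BorelSpace.measurable_eq (α := X), borel_eq_generateFrom_isClosed]
      refine MeasurableSpace.generateFrom_le fun F hF => ?_
      have : F = ⋃ i, F ∩ compactCovering X i := by
        rw [← Set.inter_iUnion, iUnion_compactCovering, Set.inter_univ]
      rw [this]
      exact MeasurableSet.iUnion fun i => MeasurableSpace.measurableSet_generateFrom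
        ((isCompact_compactCovering X i).inter_left hF)
    · exact MeasurableSpace.generateFrom_le fun K hK => IsCompact.measurableSet hK
  · intro K hK L hL _
    exact IsCompact.inter hK hL
  · rw [hb (isCompact_compactCovering X i).measurableSet,
      hπ.lintegral_toMeasure_of_isCompact (isCompact_compactCovering X i)]
    exact (isCompact_compactCovering X i).measure_lt_top.ne
  · rw [hb (IsCompact.measurableSet hK), hπ.lintegral_toMeasure_of_isCompact hK]

/-- A Poisson process has a point in a given set with probability at most the intensity. -/
theorem measure_toMeasure_ne_zero_le (hπ : IsPoisson σ π) {A : Set X} (hA : MeasurableSet A) :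
    π {ω | ω.toMeasure A ≠ 0} ≤ σ A := by
  rw [← hπ.lintegral_toMeasure hA]
  have h := mul_meas_ge_le_lintegral₀ (μ := π) (measurable_toMeasure_apply hA).aemeasurable 1
  rw [one_mul] at h
  refine le_trans (measure_mono fun ω hω => ?_) h
  simp only [Set.mem_ofPred_eq] at hω ⊢
  rw [toMeasure_apply ω hA] at hω ⊢
  have : ω.carrier ∩ A ≠ ∅ := fun h => hω (by simp [h])
  have h1 : (1 : ℕ∞) ≤ (ω.carrier ∩ A).encard :=
    Set.one_le_encard_iff_nonempty.2 (Set.nonempty_iff_ne_empty.2 this)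
  exact_mod_cast h1

/-- This is where diffuseness enters: the expected number of points at `x` is `σ {x} = 0`. -/
theorem ae_notMem_carrier [NullSingletonClass σ] (hπ : IsPoisson σ π) (x : X) :
    ∀ᵐ ω ∂π, x ∉ ω.carrier := by
  have h := hπ.measure_toMeasure_ne_zero_le (measurableSet_singleton x)
  rw [measure_singleton, nonpos_iff_eq_zero] at h
  refine measure_mono_null (fun ω hω => ?_) h
  rw [Set.mem_ofPred_eq, Ne, toMeasure_eq_zero_iff _ (measurableSet_singleton x)]
  exact Set.Nonempty.ne_empty ⟨x, not_not.1 hω, rfl⟩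

variable [IsProbabilityMeasure π]

/-- Inner regularity of `σ` on `K` gives compact `L j i ⊆ A i` with `σ (A i \ L j i) → 0`. The
counts on `A i` and `L j i` differ only if `ω` charges the difference, which has probability at most
its intensity. The Poisson weights are continuous in the parameter, so the compact case passes to
the limit. -/
theorem measure_forall_eq (hπ : IsPoisson σ π) {ι : Type*} [Fintype ι] {K : Set X}
    (hK : IsCompact K) {A : ι → Set X} (hA : ∀ i, MeasurableSet (A i)) (hAK : ∀ i, A i ⊆ K)
    (hd : Pairwise fun i j => Disjoint (A i) (A j)) (n : ι → ℕ) :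
    π {ω | ∀ i, ω.toMeasure (A i) = n i} = ∏ i, poissonMeasure (σ (A i)).toNNReal {n i} := by
  have hfin : ∀ i, σ (A i) ≠ ∞ := fun i =>
    ((measure_mono (hAK i)).trans_lt hK.measure_lt_top).ne
  have : IsFiniteMeasure (σ.restrict K) := ⟨by simpa using hK.measure_lt_top⟩
  have hex : ∀ (j : ℕ) (i : ι), ∃ L ⊆ A i, IsCompact L ∧ σ (A i \ L) < (j + 1 : ℝ≥0∞)⁻¹ := by
    intro j i
    obtain ⟨L, hL, hLc, hLσ⟩ := (hA i).exists_isCompact_sdiff_lt (μ := σ.restrict K)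
      (measure_ne_top _ _) (ε := (j + 1 : ℝ≥0∞)⁻¹) (by simp)
    refine ⟨L, hL, hLc, ?_⟩
    rwa [Measure.restrict_apply ((hA i).diff hLc.measurableSet),
      Set.inter_eq_left.2 (Set.sdiff_subset.trans (hAK i))] at hLσ
  choose L hLA hLc hLσ using hex
  have hinv : Filter.Tendsto (fun j : ℕ => (j + 1 : ℝ≥0∞)⁻¹) Filter.atTop (nhds 0) := by
    have := (Filter.tendsto_add_atTop_iff_nat 1).2 ENNReal.tendsto_inv_nat_nhds_zero
    simpa using this
  have hσlim : ∀ i, Filter.Tendsto (fun j => σ (A i \ L j i)) Filter.atTop (nhds 0) := fun i =>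
    tendsto_of_tendsto_of_tendsto_of_le_of_le tendsto_const_nhds hinv (fun _ => zero_le)
      fun j => (hLσ j i).le
  have hσL : ∀ i, Filter.Tendsto (fun j => (σ (L j i)).toReal) Filter.atTop
      (nhds (σ (A i)).toReal) := by
    intro i
    have h0 : Filter.Tendsto (fun j => (σ (A i)).toReal - (σ (A i \ L j i)).toReal) Filter.atTop
        (nhds ((σ (A i)).toReal - (0 : ℝ≥0∞).toReal)) :=
      tendsto_const_nhds.sub ((ENNReal.tendsto_toReal ENNReal.zero_ne_top).comp (hσlim i))
    rw [ENNReal.toReal_zero, sub_zero] at h0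
    refine h0.congr fun j => ?_
    have h1 : (σ (A i \ L j i)).toReal = (σ (A i)).toReal - (σ (L j i)).toReal := by
      rw [measure_sdiff (hLA j i) (hLc j i).measurableSet.nullMeasurableSet
        ((measure_mono (hLA j i)).trans_lt (hfin i).lt_top).ne,
        ENNReal.toReal_sub_of_le (measure_mono (hLA j i)) (hfin i)]
    rw [h1]; ring
  let S := {ω : Config X | ∀ i, ω.toMeasure (A i) = n i}
  let T := fun j => {ω : Config X | ∀ i, ω.toMeasure (L j i) = n i}
  have hmeas : ∀ {B : ι → Set X}, (∀ i, MeasurableSet (B i)) →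
      MeasurableSet {ω : Config X | ∀ i, ω.toMeasure (B i) = n i} := fun {B} hB => by
    rw [Set.ofPred_forall]
    exact MeasurableSet.iInter fun i =>
      measurable_toMeasure_apply (hB i) (measurableSet_singleton _)
  have hS : MeasurableSet S := hmeas hA
  have hT : ∀ j, MeasurableSet (T j) := fun j => hmeas fun i => (hLc j i).measurableSet
  have hST : ∀ j, symmDiff (T j) S ⊆ ⋃ i, {ω : Config X | ω.toMeasure (A i \ L j i) ≠ 0} := by
    intro j ω hω
    by_contra hcon
    simp only [Set.mem_iUnion, Set.mem_ofPred_eq, not_exists, not_not] at hcon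
    have heq : ∀ i, ω.toMeasure (A i) = ω.toMeasure (L j i) := fun i => by
      rw [← measure_sdiff_add_inter (A i) (hLc j i).measurableSet, hcon i, zero_add,
        Set.inter_eq_right.2 (hLA j i)]
    have : ω ∈ S ↔ ω ∈ T j := by simp only [S, T, Set.mem_ofPred_eq, heq]
    rcases hω with h | h
    · exact h.2 (this.2 h.1)
    · exact h.2 (this.1 h.1)
  have hbound : ∀ j, |π.real (T j) - π.real S| ≤ ∑ i, (σ (A i \ L j i)).toReal := by
    intro j
    refine (abs_measureReal_sub_le_measureReal_symmDiff (hT j).nullMeasurableSet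
      hS.nullMeasurableSet).trans ?_
    have hfinj : ∀ i, σ (A i \ L j i) ≠ ∞ := fun i =>
      ((measure_mono Set.sdiff_subset).trans_lt (hfin i).lt_top).ne
    rw [← ENNReal.toReal_sum fun i _ => hfinj i]
    refine ENNReal.toReal_mono (ENNReal.sum_ne_top.2 fun i _ => hfinj i) ?_
    refine (measure_mono (hST j)).trans ((measure_iUnion_fintype_le _ _).trans ?_)
    exact Finset.sum_le_sum fun i _ =>
      hπ.measure_toMeasure_ne_zero_le ((hA i).diff (hLc j i).measurableSet)
  have hlim1 : Filter.Tendsto (fun j => π.real (T j)) Filter.atTop (nhds (π.real S)) := by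
    rw [tendsto_iff_dist_tendsto_zero]
    refine squeeze_zero (fun _ => dist_nonneg) hbound ?_
    have := tendsto_finsetSum Finset.univ fun i (_ : i ∈ Finset.univ) =>
      (ENNReal.tendsto_toReal ENNReal.zero_ne_top).comp (hσlim i)
    simpa using this
  have hT' : ∀ j, π.real (T j) = ∏ i, (Real.exp (-(σ (L j i)).toReal) *
      (σ (L j i)).toReal ^ n i / (n i).factorial) := by
    intro j
    rw [measureReal_def, hπ.measure_forall_eq_of_isCompact (hLc j)
      (fun a b hab => (hd hab).mono (hLA j a) (hLA j b)), ENNReal.toReal_prod]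
    refine Finset.prod_congr rfl fun i _ => ?_
    rw [← measureReal_def, poissonMeasure_real_singleton]
    rfl
  have hlim2 : Filter.Tendsto (fun j => π.real (T j)) Filter.atTop
      (nhds (∏ i, (Real.exp (-(σ (A i)).toReal) *
      (σ (A i)).toReal ^ n i / (n i).factorial))) := by
    simp_rw [hT']
    refine tendsto_finsetProd _ fun i _ => ?_
    have hc : Continuous fun t : ℝ => Real.exp (-t) * t ^ n i / (n i).factorial := by fun_prop
    exact (hc.tendsto _).comp (hσL i)
  have := tendsto_nhds_unique hlim1 hlim2
  rw [← ENNReal.toReal_eq_toReal_iff' (measure_ne_top _ _)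
    (ENNReal.prod_ne_top fun i _ => measure_ne_top _ _), ENNReal.toReal_prod]
  refine this.trans (Finset.prod_congr rfl fun i _ => ?_)
  rw [← measureReal_def (poissonMeasure _), poissonMeasure_real_singleton]
  rfl

theorem map_count (hπ : IsPoisson σ π) {ι : Type*} [Fintype ι] {K : Set X}
    (hK : IsCompact K) {A : ι → Set X} (hA : ∀ i, MeasurableSet (A i)) (hAK : ∀ i, A i ⊆ K)
    (hd : Pairwise fun i j => Disjoint (A i) (A j)) :
    π.map (fun ω i => ω.count (A i)) = Measure.pi fun i => poissonMeasure (σ (A i)).toNNReal := by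
  refine Measure.ext_of_singleton fun n => ?_
  rw [Measure.map_apply (measurable_pi_lambda _ fun i => measurable_count hK (hAK i) (hA i))
    (measurableSet_singleton _), Measure.pi_singleton, ← hπ.measure_forall_eq hK hA hAK hd]
  congr 1
  ext ω
  simp only [Set.mem_preimage, Set.mem_singleton_iff, Set.mem_ofPred_eq, funext_iff,
    ω.count_eq_iff hK (hAK _) (hA _)]

end IsPoisson
end Config

/-! ### Mecke's formula for one added point -/

namespace Config

variable {X : Type*} [MetricSpace X]

theorem count_biUnion [MeasurableSpace X] (ω : Config X) {ι : Type*}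
    {K : Set X} (hK : IsCompact K) {A : ι → Set X} (hA : ∀ i, MeasurableSet (A i))
    (hAK : ∀ i, A i ⊆ K) (hd : Pairwise fun i j => Disjoint (A i) (A j)) (D : Finset ι) :
    ω.count (⋃ i ∈ D, A i) = ∑ i ∈ D, ω.count (A i) := by
  rw [count_eq_iff ω hK (Set.iUnion₂_subset fun i _ => hAK i)
    (D.measurableSet_biUnion fun i _ => hA i),
    measure_biUnion_finset (fun i _ j _ hij => hd hij) fun i _ => hA i]
  push_cast
  exact Finset.sum_congr rfl fun i _ => (ω.coe_count hK (hAK i) (hA i)).symm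

theorem count_addPoint {ω : Config X} {x : X} (hx : x ∉ ω.carrier) {K A : Set X}
    (hK : IsCompact K) (hAK : A ⊆ K) [Decidable (x ∈ A)] :
    (ω.addPoint x).count A = ω.count A + if x ∈ A then 1 else 0 := by
  have hf : (ω.carrier ∩ A).Finite :=
    (ω.locallyFinite K hK).subset (Set.inter_subset_inter_right _ hAK)
  rw [count, count, carrier_addPoint, Set.union_inter_distrib_right]
  split_ifs with h
  · rw [Set.inter_eq_left.2 (Set.singleton_subset_iff.2 h), Set.union_singleton,
      Set.ncard_insert_of_notMem (fun hx' => hx hx'.1) hf]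
  · rw [Set.singleton_inter_eq_empty.2 h, Set.union_empty, add_zero]

variable [MeasurableSpace X]

/-- The events prescribing the number of points in finitely many relatively compact sets. -/
def countEvents (X : Type*) [MetricSpace X] [MeasurableSpace X] : Set (Set (Config X)) :=
  {S | ∃ T : Finset (Set X × ℕ), (∀ p ∈ T, MeasurableSet p.1 ∧ ∃ K, IsCompact K ∧ p.1 ⊆ K) ∧
    S = {ω | ∀ p ∈ T, ω.count p.1 = p.2}}

theorem isPiSystem_countEvents : IsPiSystem (countEvents X) := by
  classical
  rintro _ ⟨T, hT, rfl⟩ _ ⟨T', hT', rfl⟩ _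
  refine ⟨T ∪ T', fun p hp => ?_, ?_⟩
  · rcases Finset.mem_union.1 hp with h | h
    exacts [hT p h, hT' p h]
  · ext ω
    simp only [Set.mem_inter_iff, Set.mem_ofPred_eq, Finset.mem_union, or_imp, forall_and]

variable [BorelSpace X]

/-- Relatively compact sets suffice, since `ω(A)` is the supremum of its values on the intersections
of `A` with a compact exhaustion. -/
theorem generateFrom_countEvents [SigmaCompactSpace X] :
    (instMeasurableSpace : MeasurableSpace (Config X)) =
      MeasurableSpace.generateFrom (countEvents X) := by
  apply le_antisymm
  · rw [instMeasurableSpace, ← measurable_iff_comap_le]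
    refine Measure.measurable_of_measurable_coe _ fun A hA => ?_
    have h1 : ∀ n : ℕ, @Measurable _ _ (MeasurableSpace.generateFrom (countEvents X)) _
        fun ω : Config X => ω.toMeasure (A ∩ compactCovering X n) := by
      intro n
      have hc := isCompact_compactCovering X n
      have hm := hA.inter hc.measurableSet
      simp_rw [← coe_count _ hc Set.inter_subset_right hm]
      refine (measurable_of_countable (fun k : ℕ => (k : ℝ≥0∞))).comp ?_
      refine @measurable_to_countable' _ _ _ _ (MeasurableSpace.generateFrom _) _ fun k => ?_
      refine MeasurableSpace.measurableSet_generateFrom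
        ⟨{(A ∩ compactCovering X n, k)}, ?_, ?_⟩
      · simp only [Finset.mem_singleton, forall_eq]
        exact ⟨hm, _, hc, Set.inter_subset_right⟩
      · ext ω; simp
    have h2 : (fun ω : Config X => ω.toMeasure A) =
        fun ω => ⨆ n, ω.toMeasure (A ∩ compactCovering X n) := by
      ext1 ω
      rw [← Monotone.measure_iUnion, ← Set.inter_iUnion, iUnion_compactCovering, Set.inter_univ]
      exact fun m n hmn => Set.inter_subset_inter_right _ (compactCovering_subset X hmn)
    rw [h2]
    exact Measurable.iSup h1
  · refine MeasurableSpace.generateFrom_le ?_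
    rintro _ ⟨T, hT, rfl⟩
    have : {ω : Config X | ∀ p ∈ T, ω.count p.1 = p.2} =
        ⋂ p ∈ T, (fun ω : Config X => ω.count p.1) ⁻¹' {p.2} := by
      ext ω; simp
    rw [this]
    refine T.measurableSet_biInter fun p hp => ?_
    obtain ⟨hm, K, hK, hpK⟩ := hT p hp
    exact measurable_count hK hpK hm (measurableSet_singleton _)

namespace IsPoisson

variable {σ : Measure X} {π : Measure (Config X)} [IsFiniteMeasureOnCompacts σ]
  [NullSingletonClass σ] [SigmaCompactSpace X] [IsProbabilityMeasure π]

/-- Adding a point `x ∈ A b`, almost surely new, raises the count of `A b` by one and leaves the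
other counts alone. The inner integral is therefore constant in `x ∈ A b`, and the claim is the
Chen-Stein identity in coordinate `b`. -/
theorem lintegral_toMeasure_mul_count_part (hπ : IsPoisson σ π) {ι : Type*} [Fintype ι]
    {K : Set X} (hK : IsCompact K) {A : ι → Set X} (hA : ∀ i, MeasurableSet (A i))
    (hAK : ∀ i, A i ⊆ K) (hd : Pairwise fun i j => Disjoint (A i) (A j))
    (f : (ι → ℕ) → ℝ≥0∞) (b : ι) :
    ∫⁻ ω, ω.toMeasure (A b) * f (fun i => ω.count (A i)) ∂π =
      ∫⁻ x in A b, ∫⁻ ω, f (fun i => (ω.addPoint x).count (A i)) ∂π ∂σ := by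
  classical
  have hmap := hπ.map_count hK hA hAK hd
  have hmeas : Measurable fun (ω : Config X) i => ω.count (A i) :=
    measurable_pi_lambda _ fun i => measurable_count hK (hAK i) (hA i)
  have hfin : σ (A b) ≠ ∞ := ((measure_mono (hAK b)).trans_lt hK.measure_lt_top).ne
  have h1 : ∀ x ∈ A b, ∫⁻ ω, f (fun i => (ω.addPoint x).count (A i)) ∂π =
      ∫⁻ n, f (n + Pi.single b 1) ∂(Measure.pi fun i => poissonMeasure (σ (A i)).toNNReal) := by
    intro x hx
    rw [← hmap, lintegral_map (measurable_of_countable _) hmeas]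
    refine lintegral_congr_ae ((hπ.ae_notMem_carrier x).mono fun ω hω => ?_)
    beta_reduce
    congr 1
    funext i
    rw [count_addPoint hω hK (hAK i), Pi.add_apply, Pi.single_apply]
    congr 1
    by_cases hi : i = b
    · subst hi; simp [hx]
    · simp [hi, Set.disjoint_right.1 (hd hi) hx]
  have h2 := lintegral_pi_poissonMeasure_mul (fun i => (σ (A i)).toNNReal) f b
  beta_reduce at h2
  rw [ENNReal.coe_toNNReal hfin] at h2
  rw [setLIntegral_congr_fun (hA b) h1, setLIntegral_const, mul_comm, ← h2, ← hmap,
    lintegral_map (measurable_of_countable _) hmeas]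
  simp_rw [coe_count _ hK (hAK b) (hA b)]

/-- Mecke's identity on count events. -/
theorem lintegral_toMeasure_mul_indicator_countEvents (hπ : IsPoisson σ π) {K B : Set X}
    (hK : IsCompact K) (hBK : B ⊆ K) (hB : MeasurableSet B) {S : Set (Config X)}
    (hS : S ∈ countEvents X) :
    ∫⁻ ω, ω.toMeasure B * S.indicator 1 ω ∂π =
      ∫⁻ x in B, ∫⁻ ω, S.indicator 1 (ω.addPoint x) ∂π ∂σ := by
  classical
  obtain ⟨T, hT, rfl⟩ := hS
  have hex : ∀ p : T, ∃ K, IsCompact K ∧ p.1.1 ⊆ K := fun p => (hT p.1 p.2).2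
  choose L hLc hL using hex
  -- `M` is compact and contains `B` and all sets of the event. The map `τ` records which of these
  -- sets contain a point, so its fibres in `M` are disjoint cells from which each of the sets is
  -- assembled.
  let M := K ∪ ⋃ p, L p
  have hM : IsCompact M := hK.union (isCompact_iUnion hLc)
  let τ : X → Set T × Prop := fun x => ({p | x ∈ p.1.1}, x ∈ B)
  let A : Set T × Prop → Set X := fun a => M ∩ τ ⁻¹' {a}
  have hA : ∀ a, MeasurableSet (A a) := by
    rintro ⟨a, b⟩
    have : A (a, b) = M ∩ ((⋂ p : T, {x | x ∈ p.1.1 ↔ p ∈ a}) ∩ {x | x ∈ B ↔ b}) := by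
      ext x
      simp only [A, τ, Set.mem_inter_iff, Set.mem_preimage, Set.mem_singleton_iff, Prod.mk.injEq,
        Set.ext_iff, Set.mem_ofPred_eq, Set.mem_iInter, eq_iff_iff]
    rw [this]
    refine hM.measurableSet.inter ((MeasurableSet.iInter fun p => ?_).inter ?_)
    · by_cases h : p ∈ a
      · simpa [h] using (hT p.1 p.2).1
      · simp only [h, iff_false]
        exact (hT p.1 p.2).1.compl
    · by_cases h : b
      · simpa [h] using hB
      · simp only [h, iff_false]
        exact hB.compl
  have hAM : ∀ a, A a ⊆ M := fun a => Set.inter_subset_left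
  have hd : Pairwise fun a b => Disjoint (A a) (A b) := by
    intro a b hab
    refine Set.disjoint_left.2 fun x hx hx' => hab ?_
    exact (Set.mem_singleton_iff.1 hx.2).symm.trans (Set.mem_singleton_iff.1 hx'.2)
  have hBA : B = ⋃ a ∈ Finset.univ.filter fun a : Set T × Prop => a.2, A a := by
    ext x
    simp only [A, τ, Set.mem_iUnion, Set.mem_inter_iff, Set.mem_preimage, Set.mem_singleton_iff,
      Finset.mem_filter, Finset.mem_univ, true_and]
    constructor
    · intro hx
      exact ⟨_, hx, Or.inl (hBK hx), rfl⟩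
    · rintro ⟨a, ha, -, rfl⟩
      exact ha
  have hTA : ∀ p : T, p.1.1 = ⋃ a ∈ Finset.univ.filter fun a : Set T × Prop => p ∈ a.1, A a := by
    intro p
    ext x
    simp only [A, τ, Set.mem_iUnion, Set.mem_inter_iff, Set.mem_preimage, Set.mem_singleton_iff,
      Finset.mem_filter, Finset.mem_univ, true_and]
    constructor
    · intro hx
      exact ⟨_, hx, Or.inr (Set.mem_iUnion.2 ⟨p, hL p hx⟩), rfl⟩
    · rintro ⟨a, ha, -, rfl⟩
      exact ha
  -- The indicator of the event, expressed through the counts of the cells.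
  let f : (Set T × Prop → ℕ) → ℝ≥0∞ := fun n =>
    if ∀ p : T, ∑ a ∈ Finset.univ.filter (fun a : Set T × Prop => p ∈ a.1), n a = p.1.2
    then 1 else 0
  have hf : ∀ ω : Config X, Set.indicator {ω : Config X | ∀ p ∈ T, ω.count p.1 = p.2} 1 ω =
      f fun a => ω.count (A a) := by
    intro ω
    simp only [f, Set.indicator_apply, Set.mem_ofPred_eq, Pi.one_apply]
    refine if_congr ?_ rfl rfl
    simp only [← count_biUnion ω hM hA hAM hd, ← hTA]
    exact ⟨fun h p => h p.1 p.2, fun h p hp => h ⟨p, hp⟩⟩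
  simp only [hf]
  have hBm : ∀ ω : Config X, ω.toMeasure B =
      ∑ a ∈ Finset.univ.filter (fun a : Set T × Prop => a.2), ω.toMeasure (A a) := by
    intro ω
    conv_lhs => rw [hBA]
    exact measure_biUnion_finset (fun i _ j _ hij => hd hij) fun i _ => hA i
  simp only [hBm, Finset.sum_mul]
  have hmeas : Measurable fun (ω : Config X) a => ω.count (A a) :=
    measurable_pi_lambda _ fun i => measurable_count hM (hAM i) (hA i)
  have hmul : ∀ a, Measurable fun ω : Config X => ω.toMeasure (A a) * f fun a => ω.count (A a) :=
    fun a => (measurable_toMeasure_apply (hA a)).mul ((measurable_of_countable f).comp hmeas)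
  rw [lintegral_finsetSum _ fun a _ => hmul a]
  simp only [hπ.lintegral_toMeasure_mul_count_part hM hA hAM hd f]
  conv_rhs => rw [hBA]
  rw [lintegral_biUnion_finset (fun i _ j _ hij => hd hij) fun i _ => hA i]

/-- Mecke's identity for a fixed relatively compact set of added points. -/
theorem withDensity_toMeasure_eq_map_addPoint (hπ : IsPoisson σ π) {K B : Set X}
    (hK : IsCompact K) (hBK : B ⊆ K) (hB : MeasurableSet B) :
    π.withDensity (fun ω => ω.toMeasure B) =
      (π.prod (σ.restrict B)).map fun p => p.1.addPoint p.2 := by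
  have hfin : σ B < ∞ := (measure_mono hBK).trans_lt hK.measure_lt_top
  have : IsFiniteMeasure (σ.restrict B) := ⟨by simpa using hfin⟩
  have h1 : ∀ S, MeasurableSet S → π.withDensity (fun ω => ω.toMeasure B) S =
      ∫⁻ ω, ω.toMeasure B * S.indicator 1 ω ∂π := by
    intro S hS
    rw [withDensity_apply _ hS, ← lintegral_indicator hS]
    refine lintegral_congr fun ω => ?_
    by_cases h : ω ∈ S <;> simp [h]
  have h2 : ∀ S, MeasurableSet S → (π.prod (σ.restrict B)).map (fun p => p.1.addPoint p.2) S =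
      ∫⁻ x in B, ∫⁻ ω, S.indicator 1 (ω.addPoint x) ∂π ∂σ := by
    intro S hS
    rw [← lintegral_indicator_one hS, lintegral_map (measurable_one.indicator hS)
      measurable_addPoint, lintegral_prod_symm]
    exact ((measurable_one.indicator hS).comp measurable_addPoint).aemeasurable
  have : IsFiniteMeasure (π.withDensity fun ω => ω.toMeasure B) := by
    refine isFiniteMeasure_withDensity ?_
    rw [hπ.lintegral_toMeasure hB]
    exact hfin.ne
  -- Both measures are finite with total mass `σ B`, so agreement on the π-system of count events
  -- suffices.
  refine ext_of_generate_finite _ generateFrom_countEvents isPiSystem_countEvents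
    (fun S hS => ?_) ?_
  · have hSm : MeasurableSet S := by
      rw [generateFrom_countEvents]; exact MeasurableSpace.measurableSet_generateFrom hS
    rw [h1 S hSm, h2 S hSm, hπ.lintegral_toMeasure_mul_indicator_countEvents hK hBK hB hS]
  · rw [h1 _ MeasurableSet.univ, h2 _ MeasurableSet.univ]
    simp [hπ.lintegral_toMeasure hB]

/-- **Mecke's formula**, for points in a compact set. -/
theorem compProd_restrictKernel (hπ : IsPoisson σ π) {K : Set X} (hK : IsCompact K) :
    π ⊗ₘ restrictKernel hK =
      (π.prod (σ.restrict K)).map fun p => (p.1.addPoint p.2, p.2) := by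
  have : IsFiniteMeasure (σ.restrict K) := ⟨by simpa using hK.measure_lt_top⟩
  have hm : Measurable fun p : Config X × X => (p.1.addPoint p.2, p.2) :=
    measurable_addPoint.prodMk measurable_snd
  have hL : ∀ S B, MeasurableSet S → MeasurableSet B →
      (π ⊗ₘ restrictKernel hK) (S ×ˢ B) = π.withDensity (fun ω => ω.toMeasure (B ∩ K)) S := by
    intro S B hS hB
    rw [Measure.compProd_apply_prod hS hB, withDensity_apply _ hS]
    simp only [restrictKernel_apply, Measure.restrict_apply hB]
  have : IsFiniteMeasure (π ⊗ₘ restrictKernel hK) := by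
    refine ⟨?_⟩
    rw [← Set.univ_prod_univ, hL _ _ MeasurableSet.univ MeasurableSet.univ,
      withDensity_apply _ MeasurableSet.univ, Measure.restrict_univ, Set.univ_inter,
      hπ.lintegral_toMeasure hK.measurableSet]
    exact hK.measure_lt_top
  -- On a rectangle `S ×ˢ B` the second factor only restricts the added point to `B ∩ K`, which is
  -- the case of a fixed set.
  refine Measure.ext_prod fun {S B} hS hB => ?_
  rw [hL S B hS hB, hπ.withDensity_toMeasure_eq_map_addPoint hK Set.inter_subset_right
    (hB.inter hK.measurableSet), Measure.map_apply measurable_addPoint hS,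
    Measure.map_apply hm (hS.prod hB), ← Measure.restrict_restrict hB]
  conv_lhs => rw [← Measure.restrict_univ (μ := π), Measure.prod_restrict]
  rw [Measure.restrict_apply (measurable_addPoint hS)]
  congr 1
  ext p
  simp

theorem lintegral_lintegral_restrict (hπ : IsPoisson σ π) {K : Set X} (hK : IsCompact K)
    {f : Config X × X → ℝ≥0∞} (hf : Measurable f) :
    ∫⁻ ω, ∫⁻ x, f (ω, x) ∂(ω.toMeasure.restrict K) ∂π =
      ∫⁻ ω, ∫⁻ x, f (ω.addPoint x, x) ∂(σ.restrict K) ∂π := by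
  have : IsFiniteMeasure (σ.restrict K) := ⟨by simpa using hK.measure_lt_top⟩
  have hm : Measurable fun p : Config X × X => (p.1.addPoint p.2, p.2) :=
    measurable_addPoint.prodMk measurable_snd
  have h := congrArg (fun μ => ∫⁻ p, f p ∂μ) (hπ.compProd_restrictKernel hK)
  beta_reduce at h
  rwa [Measure.lintegral_compProd hf, lintegral_map hf hm,
    lintegral_prod (fun p : Config X × X => f (p.1.addPoint p.2, p.2)) (hf.comp hm).aemeasurable] at h

end IsPoisson
end Config

/-! ### Mecke's formula for several distinct points -/

theorem MeasureTheory.Measure.map_pi_comp_equiv {X ι ι' : Type*} [MeasurableSpace X] [Fintype ι]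
    [Fintype ι'] (e : ι ≃ ι') (μ : Measure X) [SigmaFinite μ] :
    (Measure.pi fun _ : ι' => μ).map (fun s => s ∘ e) = Measure.pi fun _ : ι => μ := by
  have hm : Measurable fun s : ι' → X => s ∘ e :=
    measurable_pi_lambda _ fun i => measurable_pi_apply (e i)
  refine (Measure.pi_eq fun A hA => ?_).symm
  rw [Measure.map_apply hm (MeasurableSet.univ_pi hA)]
  have : (fun s : ι' → X => s ∘ e) ⁻¹' Set.pi Set.univ A =
      Set.pi Set.univ fun j => A (e.symm j) := by
    ext s
    simp only [Set.mem_preimage, Set.mem_univ_pi, Function.comp_apply]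
    exact ⟨fun h j => by simpa using h (e.symm j), fun h i => by simpa using h (e i)⟩
  rw [this, Measure.pi_pi]
  exact e.symm.prod_comp fun i => μ (A i)

theorem MeasureTheory.lintegral_pi_fin_succ {X : Type*} [MeasurableSpace X] {n : ℕ}
    (μ : Measure X) [SigmaFinite μ] {h : (Fin (n + 1) → X) → ℝ≥0∞} (hh : Measurable h) :
    ∫⁻ x, h x ∂(Measure.pi fun _ => μ) =
      ∫⁻ s, ∫⁻ x, h (Fin.cons x s) ∂μ ∂(Measure.pi fun _ : Fin n => μ) := by
  have h1 := (measurePreserving_piFinSuccAbove (fun _ : Fin (n + 1) => μ) 0).symm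
  rw [← h1.lintegral_comp hh, lintegral_prod_symm]
  · simp [MeasurableEquiv.piFinSuccAbove, Fin.insertNthEquiv]
  · exact (hh.comp h1.measurable).aemeasurable

theorem MeasureTheory.measurableSet_injective {X ι : Type*} [Finite ι] [TopologicalSpace X]
    [T2Space X] [SecondCountableTopology X] [MeasurableSpace X] [BorelSpace X] :
    MeasurableSet {x : ι → X | Function.Injective x} := by
  have : {x : ι → X | Function.Injective x} = ⋂ i, ⋂ j, {x : ι → X | i ≠ j → x i ≠ x j} := by
    ext x
    simp only [Set.mem_ofPred_eq, Set.mem_iInter]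
    exact ⟨fun h i j => h.ne, fun h i j hij => not_imp_not.1 (h i j) hij⟩
  rw [this]
  refine MeasurableSet.iInter fun i => MeasurableSet.iInter fun j => ?_
  by_cases hij : i = j
  · simp [hij]
  · simp only [ne_eq, hij, not_false_eq_true, forall_const]
    exact (measurableSet_eq_fun (measurable_pi_apply i) (measurable_pi_apply j)).compl

theorem MeasureTheory.measurableSet_mem_range {X ι : Type*} [Finite ι] [TopologicalSpace X]
    [T2Space X] [SecondCountableTopology X] [MeasurableSpace X] [BorelSpace X] :
    MeasurableSet {p : (ι → X) × X | p.2 ∈ Set.range p.1} := by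
  have : {p : (ι → X) × X | p.2 ∈ Set.range p.1} = ⋃ i, {p : (ι → X) × X | p.1 i = p.2} := by
    ext p; simp
  rw [this]
  exact MeasurableSet.iUnion fun i =>
    measurableSet_eq_fun ((measurable_pi_apply i).comp measurable_fst) measurable_snd

namespace Config

variable {X : Type*} [MetricSpace X] [MeasurableSpace X] [BorelSpace X]

theorem lintegral_restrict_toMeasure (ω : Config X) {K : Set X} (hK : IsCompact K)
    (g : X → ℝ≥0∞) :
    ∫⁻ x, g x ∂(ω.toMeasure.restrict K) = ∑ x ∈ ω.pointsIn hK, g x := by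
  rw [restrict_toMeasure ω hK, lintegral_finsetSum_measure]
  simp

theorem lintegral_restrict_toMeasure_addPoints {ι : Type*} [Finite ι] (ω : Config X) {K : Set X}
    (hK : IsCompact K) (s : ι → X) {g : X → ℝ≥0∞} (hg : ∀ x ∈ Set.range s, g x = 0) :
    ∫⁻ x, g x ∂((ω.addPoints s).toMeasure.restrict K) = ∫⁻ x, g x ∂(ω.toMeasure.restrict K) := by
  rw [lintegral_restrict_toMeasure _ hK, lintegral_restrict_toMeasure _ hK]
  symm
  refine Finset.sum_subset (fun x hx => ?_) fun x hx hx' => ?_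
  · rw [mem_pointsIn] at hx ⊢
    exact ⟨Or.inl hx.1, hx.2⟩
  · rw [mem_pointsIn] at hx hx'
    rcases hx.1 with h | h
    · exact (hx' ⟨h, hx.2⟩).elim
    · exact hg x h

theorem lintegral_pi_restrict_toMeasure {ι : Type*} [Fintype ι] [DecidableEq ι] (ω : Config X)
    {K : Set X} (hK : IsCompact K) (h : (ι → X) → ℝ≥0∞) :
    ∫⁻ x, h x ∂(Measure.pi fun _ : ι => ω.toMeasure.restrict K) =
      ∑ x ∈ Fintype.piFinset fun _ : ι => ω.pointsIn hK, h x := by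
  have := ω.isFiniteMeasure_restrict hK
  have key : (Measure.pi fun _ : ι => ω.toMeasure.restrict K) =
      ∑ x ∈ Fintype.piFinset fun _ : ι => ω.pointsIn hK, Measure.dirac x := by
    refine Measure.pi_eq fun A hA => ?_
    rw [Measure.finsetSum_apply]
    simp only [restrict_toMeasure ω hK, Measure.finsetSum_apply, Finset.prod_univ_sum]
    refine Finset.sum_congr rfl fun x _ => ?_
    rw [Measure.dirac_apply' _ (MeasurableSet.univ_pi hA)]
    simp only [Measure.dirac_apply' _ (hA _)]
    by_cases hx : x ∈ Set.pi Set.univ A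
    · rw [Set.indicator_of_mem hx]
      exact (Finset.prod_eq_one fun i _ => by simp [hx i (Set.mem_univ i)]).symm
    · rw [Set.indicator_of_notMem hx]
      simp only [Set.mem_univ_pi, not_forall] at hx
      obtain ⟨i, hi⟩ := hx
      exact (Finset.prod_eq_zero (Finset.mem_univ i) (by simp [hi])).symm
  rw [key, lintegral_finsetSum_measure]
  simp

namespace IsPoisson

variable {σ : Measure X} {π : Measure (Config X)} [IsFiniteMeasureOnCompacts σ]
  [NullSingletonClass σ] [SigmaCompactSpace X] [IsProbabilityMeasure π]

/-- Induction on the number of points: sum over the first point `x` with the others `s` fixed, apply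
the induction hypothesis to `s`, then the one-point formula to `x`. The function `g` encodes that
`x` must avoid `s`. -/
theorem lintegral_pi_injective_fin (hπ : IsPoisson σ π) {K : Set X} (hK : IsCompact K) (n : ℕ)
    {f : Config X × (Fin n → X) → ℝ≥0∞} (hf : Measurable f) :
    ∫⁻ ω, ∫⁻ x, {x | Function.Injective x}.indicator (fun x => f (ω, x)) x
        ∂(Measure.pi fun _ => ω.toMeasure.restrict K) ∂π =
      ∫⁻ ω, ∫⁻ s, f (ω.addPoints s, s) ∂(Measure.pi fun _ => σ.restrict K) ∂π := by
  classical
  have : SecondCountableTopology X := EMetric.secondCountable_of_sigmaCompact X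
  have : IsFiniteMeasure (σ.restrict K) := ⟨by simpa using hK.measure_lt_top⟩
  induction n with
  | zero =>
    refine lintegral_congr fun ω => ?_
    have := ω.isFiniteMeasure_restrict hK
    rw [lintegral_unique, lintegral_unique, Measure.pi_univ, Measure.pi_univ]
    simp [addPoints_of_isEmpty, Function.injective_of_subsingleton]
  | succ n ih =>
    let g : Config X × (Fin n → X) → X → ℝ≥0∞ := fun p x =>
      if x ∈ Set.range p.2 then 0 else f (p.1, Fin.cons x p.2)
    have hcons : Measurable fun q : (Config X × (Fin n → X)) × X =>
        ((q.1.1, Fin.cons q.2 q.1.2) : Config X × (Fin (n + 1) → X)) := by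
      refine (measurable_fst.comp measurable_fst).prodMk (measurable_pi_lambda _ fun i => ?_)
      refine Fin.cases ?_ (fun j => ?_) i
      · simpa using measurable_snd
      · simpa [Function.comp_def] using
          (measurable_pi_apply j).comp (measurable_snd.comp measurable_fst)
    have hg : Measurable (Function.uncurry g) := by
      refine Measurable.ite ?_ measurable_const (hf.comp hcons)
      exact ((measurable_snd.comp measurable_fst).prodMk measurable_snd) measurableSet_mem_range
    have hg' : Measurable fun p : Config X × (Fin n → X) =>
        ∫⁻ x, g p x ∂(p.1.toMeasure.restrict K) :=
      Measurable.lintegral_kernel_prod_right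
        (κ := (restrictKernel hK).prodMkRight (Fin n → X)) hg
    have hadd : Measurable fun p : Config X × (Fin n → X) => (p.1.addPoints p.2, p.2) :=
      measurable_addPoints.prodMk measurable_snd
    calc _ = ∫⁻ ω, ∫⁻ s, {x | Function.Injective x}.indicator
            (fun s => ∫⁻ x, g (ω, s) x ∂(ω.toMeasure.restrict K)) s
            ∂(Measure.pi fun _ => ω.toMeasure.restrict K) ∂π := by
          refine lintegral_congr fun ω => ?_
          have := ω.isFiniteMeasure_restrict hK
          have hfω : Measurable fun x => f (ω, x) := hf.comp measurable_prodMk_left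
          rw [lintegral_pi_fin_succ _ (hfω.indicator measurableSet_injective)]
          refine lintegral_congr fun s => ?_
          simp only [Set.indicator_apply, Set.mem_ofPred_eq, Fin.cons_injective_iff, g]
          by_cases hs : Function.Injective s
          · simp only [hs, and_true, if_true, ite_not]
          · simp [hs]
      _ = ∫⁻ ω, ∫⁻ s, ∫⁻ x, g (ω.addPoints s, s) x ∂((ω.addPoints s).toMeasure.restrict K)
            ∂(Measure.pi fun _ => σ.restrict K) ∂π := ih hg'
      _ = ∫⁻ s, ∫⁻ ω, ∫⁻ x, g (ω.addPoints s, s) x ∂((ω.addPoints s).toMeasure.restrict K) ∂π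
            ∂(Measure.pi fun _ => σ.restrict K) :=
          lintegral_lintegral_swap (hg'.comp hadd).aemeasurable
      _ = ∫⁻ s, ∫⁻ ω, ∫⁻ x, f (ω.addPoints (Fin.cons x s : Fin (n + 1) → X), Fin.cons x s)
            ∂(σ.restrict K) ∂π ∂(Measure.pi fun _ => σ.restrict K) := by
          refine lintegral_congr fun s => ?_
          -- As `g` vanishes on the points of `s`, the integral against `ω ∪ s` reduces to one
          -- against `ω`, to which the one-point formula applies.
          have h1 : ∀ ω : Config X, ∫⁻ x, g (ω.addPoints s, s) x
              ∂((ω.addPoints s).toMeasure.restrict K) =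
              ∫⁻ x, g (ω.addPoints s, s) x ∂(ω.toMeasure.restrict K) := fun ω =>
            ω.lintegral_restrict_toMeasure_addPoints hK s fun x hx => if_pos hx
          simp only [h1]
          have h2 : Measurable fun q : Config X × X => g (q.1.addPoints s, s) q.2 := by
            have : Measurable fun q : Config X × X => ((q.1.addPoints s, s), q.2) :=
              ((measurable_addPoints.comp (measurable_fst.prodMk measurable_const)).prodMk
                measurable_const).prodMk measurable_snd
            exact hg.comp this
          rw [hπ.lintegral_lintegral_restrict hK h2]
          refine lintegral_congr fun ω => lintegral_congr_ae ?_
          -- The restriction `x ∉ s` may now be dropped, since a diffuse measure does not charge a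
          -- finite set.
          have h3 : ∀ᵐ x ∂(σ.restrict K), x ∉ Set.range s :=
            ae_restrict_of_ae
              (measure_eq_zero_iff_ae_notMem.1 ((Set.finite_range s).measure_zero σ))
          filter_upwards [h3] with x hx
          simp only [g, if_neg hx, addPoint_addPoints, ← addPoints_cons]
      _ = ∫⁻ ω, ∫⁻ s, ∫⁻ x, f (ω.addPoints (Fin.cons x s : Fin (n + 1) → X), Fin.cons x s)
            ∂(σ.restrict K) ∂(Measure.pi fun _ => σ.restrict K) ∂π := by
          refine lintegral_lintegral_swap (Measurable.aemeasurable ?_)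
          refine Measurable.lintegral_prod_right' (f := fun q : ((Fin n → X) × Config X) × X =>
            f (q.1.2.addPoints (Fin.cons q.2 q.1.1 : Fin (n + 1) → X), Fin.cons q.2 q.1.1)) ?_
          have h4 : Measurable fun q : ((Fin n → X) × Config X) × X => ((q.1.2, q.1.1), q.2) :=
            (measurable_swap.comp measurable_fst).prodMk measurable_snd
          exact (hf.comp (measurable_addPoints.prodMk measurable_snd)).comp (hcons.comp h4)
      _ = _ := by
          refine lintegral_congr fun ω => ?_
          rw [lintegral_pi_fin_succ]
          exact (hf.comp (measurable_addPoints.prodMk measurable_snd)).comp measurable_prodMk_left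

/-- The multivariate Mecke formula, for points in a compact set. -/
theorem lintegral_pi_injective (hπ : IsPoisson σ π) {K : Set X} (hK : IsCompact K)
    {ι : Type*} [Fintype ι] {f : Config X × (ι → X) → ℝ≥0∞} (hf : Measurable f) :
    ∫⁻ ω, ∫⁻ x, {x | Function.Injective x}.indicator (fun x => f (ω, x)) x
        ∂(Measure.pi fun _ => ω.toMeasure.restrict K) ∂π =
      ∫⁻ ω, ∫⁻ s, f (ω.addPoints s, s) ∂(Measure.pi fun _ => σ.restrict K) ∂π := by
  have : SecondCountableTopology X := EMetric.secondCountable_of_sigmaCompact X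
  have : IsFiniteMeasure (σ.restrict K) := ⟨by simpa using hK.measure_lt_top⟩
  let e := Fintype.equivFin ι
  have hm : Measurable fun s : Fin (Fintype.card ι) → X => s ∘ e :=
    measurable_pi_lambda _ fun i => measurable_pi_apply (e i)
  have hf' : Measurable fun p : Config X × (Fin (Fintype.card ι) → X) => f (p.1, p.2 ∘ e) :=
    hf.comp (measurable_fst.prodMk (hm.comp measurable_snd))
  refine Eq.trans (lintegral_congr fun ω => ?_)
    ((hπ.lintegral_pi_injective_fin hK _ hf').trans (lintegral_congr fun ω => ?_))
  · have := ω.isFiniteMeasure_restrict hK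
    have hfω : Measurable fun x => f (ω, x) := hf.comp measurable_prodMk_left
    rw [← Measure.map_pi_comp_equiv e,
      lintegral_map (hfω.indicator measurableSet_injective) hm]
    refine lintegral_congr fun s => ?_
    by_cases hs : Function.Injective s <;> simp [Set.indicator, e.injective, hs]
  · have hfω : Measurable fun s : ι → X => f (ω.addPoints s, s) :=
      (hf.comp (measurable_addPoints.prodMk measurable_snd)).comp measurable_prodMk_left
    rw [← Measure.map_pi_comp_equiv e (σ.restrict K), lintegral_map hfω hm]
    simp only [addPoints_comp_equiv]

end IsPoisson
end Config

/-! ### Tuples and the partitions formed by their coincidences -/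

namespace Finpartition

variable {ι : Type*} [Fintype ι] [DecidableEq ι]

/-- The block of a partition that contains a given element. -/
def blockOf (P : Finpartition (Finset.univ : Finset ι)) (i : ι) : P.parts :=
  ⟨P.part i, P.part_mem.2 (Finset.mem_univ i)⟩

theorem blockOf_eq_iff_mem (P : Finpartition (Finset.univ : Finset ι)) {i : ι} {p : P.parts} :
    P.blockOf i = p ↔ i ∈ (p : Finset ι) := by
  rw [Subtype.ext_iff]
  exact P.part_eq_iff_mem p.2

theorem blockOf_surjective (P : Finpartition (Finset.univ : Finset ι)) :
    Function.Surjective P.blockOf := fun p => by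
  obtain ⟨i, hi⟩ := P.nonempty_of_mem_parts p.2
  exact ⟨i, P.blockOf_eq_iff_mem.2 hi⟩

theorem prod_blockOf {M : Type*} [CommMonoid M] (P : Finpartition (Finset.univ : Finset ι))
    (g : P.parts → M) : ∏ i, g (P.blockOf i) = ∏ p : P.parts, g p ^ (p : Finset ι).card := by
  rw [← Finset.prod_fiberwise' Finset.univ P.blockOf g]
  refine Finset.prod_congr rfl fun p _ => ?_
  rw [Finset.prod_const]
  congr 2
  ext i
  simp [blockOf_eq_iff_mem]

theorem eq_of_blockOf_eq_iff {P Q : Finpartition (Finset.univ : Finset ι)}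
    (h : ∀ i j, P.blockOf i = P.blockOf j ↔ Q.blockOf i = Q.blockOf j) : P = Q := by
  have hpart : ∀ i, P.part i = Q.part i := fun i => by
    ext j
    rw [P.mem_part_iff_part_eq_part (Finset.mem_univ j) (Finset.mem_univ i),
      Q.mem_part_iff_part_eq_part (Finset.mem_univ j) (Finset.mem_univ i)]
    simpa [blockOf] using h j i
  have hparts : ∀ R : Finpartition (Finset.univ : Finset ι),
      R.parts = Finset.univ.image R.part := fun R => by
    ext p
    rw [Finset.mem_image]
    constructor
    · intro hp
      obtain ⟨i, hi⟩ := R.nonempty_of_mem_parts hp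
      exact ⟨i, Finset.mem_univ i, R.part_eq_of_mem hp hi⟩
    · rintro ⟨i, hi, rfl⟩
      exact R.part_mem.2 hi
  ext1
  rw [hparts P, hparts Q, funext hpart]

/-- A sum over all tuples in a finite set, grouped by the partition of the indices given by the
coincidences of the entries. -/
theorem sum_piFinset_eq {X M : Type*} [DecidableEq X] [AddCommMonoid M] (S : Finset X)
    (h : (ι → X) → M) :
    ∑ x ∈ Fintype.piFinset fun _ : ι => S, h x =
      ∑ P : Finpartition (Finset.univ : Finset ι),
        ∑ s ∈ (Fintype.piFinset fun _ : P.parts => S) with Function.Injective s,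
          h (s ∘ P.blockOf) := by
  classical
  rw [Finset.sum_sigma']
  symm
  refine Finset.sum_bij (fun q _ => q.2 ∘ q.1.blockOf) ?_ ?_ ?_ fun _ _ => rfl
  · rintro ⟨P, s⟩ hs
    simp only [Finset.mem_sigma, Finset.mem_filter, Fintype.mem_piFinset] at hs
    simp only [Fintype.mem_piFinset, Function.comp_apply]
    exact fun i => hs.2.1 _
  · rintro ⟨P, s⟩ hs ⟨Q, t⟩ ht hst
    simp only [Finset.mem_sigma, Finset.mem_filter] at hs ht
    simp only [funext_iff, Function.comp_apply] at hst
    obtain rfl : P = Q := eq_of_blockOf_eq_iff fun i j => by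
      rw [← hs.2.2.eq_iff, hst, hst, ht.2.2.eq_iff]
    congr 1
    funext p
    obtain ⟨i, rfl⟩ := P.blockOf_surjective p
    exact hst i
  · intro x hx
    rw [Fintype.mem_piFinset] at hx
    -- The blocks are the level sets of `x`. Choosing a representative `r` of each block makes `x ∘
    -- r` injective.
    let P := Finpartition.ofSetoid (Setoid.ker x)
    choose r hr using P.blockOf_surjective
    have hxr : ∀ i, x (r (P.blockOf i)) = x i := fun i => by
      have := P.blockOf_eq_iff_mem.1 (hr (P.blockOf i))
      exact (mem_part_ofSetoid_iff_rel.1 this : x i = _).symm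
    refine ⟨⟨P, x ∘ r⟩, ?_, funext hxr⟩
    simp only [Finset.mem_sigma, Finset.mem_univ, Finset.mem_filter, Fintype.mem_piFinset,
      true_and, Function.comp_apply]
    refine ⟨fun p => hx _, fun p q hpq => ?_⟩
    obtain ⟨i, rfl⟩ := P.blockOf_surjective p
    obtain ⟨j, rfl⟩ := P.blockOf_surjective q
    simp only [Function.comp_apply, hxr] at hpq
    rw [P.blockOf_eq_iff_mem]
    exact mem_part_ofSetoid_iff_rel.2 (show x j = x i from hpq.symm)

end Finpartition

/-! ### Moment measures of the Poisson process -/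

namespace Config

variable {X : Type*} [MetricSpace X] [MeasurableSpace X] [BorelSpace X] {ι : Type*} [Fintype ι]
  [DecidableEq ι]

theorem lintegral_pi_restrict_toMeasure_eq_sum (ω : Config X) {K : Set X} (hK : IsCompact K)
    (h : (ι → X) → ℝ≥0∞) :
    ∫⁻ x, h x ∂(Measure.pi fun _ : ι => ω.toMeasure.restrict K) =
      ∑ P : Finpartition (Finset.univ : Finset ι),
        ∫⁻ s, {s | Function.Injective s}.indicator (fun s => h (s ∘ P.blockOf)) s
          ∂(Measure.pi fun _ : P.parts => ω.toMeasure.restrict K) := by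
  classical
  rw [lintegral_pi_restrict_toMeasure ω hK, Finpartition.sum_piFinset_eq]
  refine Finset.sum_congr rfl fun P _ => ?_
  rw [lintegral_pi_restrict_toMeasure ω hK, Finset.sum_filter]
  simp only [Set.indicator_apply, Set.mem_ofPred_eq]

theorem measurable_addPoints_blockOf [SigmaCompactSpace X]
    (P : Finpartition (Finset.univ : Finset ι)) :
    Measurable fun q : Config X × (P.parts → X) => (q.1.addPoints q.2, q.2 ∘ P.blockOf) :=
  measurable_addPoints.prodMk (measurable_pi_lambda _ fun i =>
    (measurable_pi_apply (P.blockOf i)).comp measurable_snd)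

/-- The moment measures of a Poisson process, as sums over partitions. -/
theorem IsPoisson.compProd_powKernel [SigmaCompactSpace X] {σ : Measure X}
    {π : Measure (Config X)} [IsFiniteMeasureOnCompacts σ] [NullSingletonClass σ]
    [IsProbabilityMeasure π] (hπ : IsPoisson σ π) {K : Set X} (hK : IsCompact K) :
    π ⊗ₘ powKernel hK ι = Measure.sum fun P : Finpartition (Finset.univ : Finset ι) =>
      (π.prod (Measure.pi fun _ : P.parts => σ.restrict K)).map
        fun q => (q.1.addPoints q.2, q.2 ∘ P.blockOf) := by
  have : SecondCountableTopology X := EMetric.secondCountable_of_sigmaCompact X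
  have : IsFiniteMeasure (σ.restrict K) := ⟨by simpa using hK.measure_lt_top⟩
  refine Measure.ext_of_lintegral _ fun f hf => ?_
  rw [Measure.lintegral_compProd hf, lintegral_sum_measure, tsum_fintype]
  have hsum : ∀ ω : Config X, ∫⁻ x, f (ω, x) ∂(powKernel hK ι ω) = _ := fun ω =>
    ω.lintegral_pi_restrict_toMeasure_eq_sum hK fun x => f (ω, x)
  rw [lintegral_congr hsum]
  have hcomp : ∀ P : Finpartition (Finset.univ : Finset ι),
      Measurable fun q : Config X × (P.parts → X) => f (q.1, q.2 ∘ P.blockOf) := fun P =>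
    hf.comp (measurable_fst.prodMk (measurable_pi_lambda _ fun i =>
      (measurable_pi_apply (P.blockOf i)).comp measurable_snd))
  rw [lintegral_finsetSum]
  · refine Finset.sum_congr rfl fun P _ => ?_
    rw [hπ.lintegral_pi_injective hK (hcomp P), lintegral_map hf (measurable_addPoints_blockOf P),
      lintegral_prod]
    exact (hf.comp (measurable_addPoints_blockOf P)).aemeasurable
  · intro P _
    refine Measurable.lintegral_kernel_prod_right' (κ := powKernel hK P.parts)
      (f := fun q => {s | Function.Injective s}.indicator (fun s => f (q.1, s ∘ P.blockOf)) q.2) ?_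
    have : (fun q : Config X × (P.parts → X) =>
        {s | Function.Injective s}.indicator (fun s => f (q.1, s ∘ P.blockOf)) q.2) =
        {q : Config X × (P.parts → X) | Function.Injective q.2}.indicator
          fun q => f (q.1, q.2 ∘ P.blockOf) := by
      rfl
    rw [this]
    exact (hcomp P).indicator (measurable_snd measurableSet_injective)

end Config

/-! ### Weighted moments and the compensated integral -/

namespace Config

variable {X : Type*} [MetricSpace X] [MeasurableSpace X] [BorelSpace X]

/-- A bounded measurable function with support in a set of finite measure is integrable. -/
theorem integrable_of_bounded_of_support {α : Type*} [MeasurableSpace α] {μ : Measure α}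
    {g : α → ℝ} (hg : Measurable g) {C : ℝ} (hC : ∀ x, |g x| ≤ C) {K : Set α}
    (hμ : μ K < ∞) (h0 : ∀ x ∉ K, g x = 0) : Integrable g μ := by
  rw [← integrableOn_iff_integrable_of_support_subset (s := K)
    fun x hx => not_imp_comm.1 (h0 x) hx]
  have : IsFiniteMeasure (μ.restrict K) := ⟨by simpa using hμ⟩
  exact Integrable.of_bound hg.aestronglyMeasurable C (ae_of_all _ hC)

variable [SigmaCompactSpace X] {σ : Measure X} {π : Measure (Config X)}
  [IsFiniteMeasureOnCompacts σ] [NullSingletonClass σ] [SigmaFinite σ] [IsProbabilityMeasure π]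

/-- The moments of the integral of a bounded compactly supported process against a Poisson
process, weighted by a bounded random variable. -/
theorem IsPoisson.integral_mul_integral_toMeasure_pow (hπ : IsPoisson σ π) {G : Config X → ℝ}
    (hG : Measurable G) {C : ℝ} (hGb : ∀ ω, |G ω| ≤ C) {u : Config X → X → ℝ}
    (hu : Measurable (Function.uncurry u)) {D : ℝ} (hub : ∀ ω x, |u ω x| ≤ D) {K : Set X}
    (hK : IsCompact K) (huc : ∀ ω, ∀ x ∉ K, u ω x = 0) (k : ℕ) :
    Integrable (fun ω => G ω * (∫ x, u ω x ∂ω.toMeasure) ^ k) π ∧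
    (∀ P : Finpartition (Finset.univ : Finset (Fin k)),
      Integrable (fun q : Config X × (P.parts → X) => G (q.1.addPoints q.2) *
        ∏ p : P.parts, u (q.1.addPoints q.2) (q.2 p) ^ (p : Finset (Fin k)).card)
        (π.prod (Measure.pi fun _ : P.parts => σ))) ∧
    ∫ ω, G ω * (∫ x, u ω x ∂ω.toMeasure) ^ k ∂π =
      ∑ P : Finpartition (Finset.univ : Finset (Fin k)),
        ∫ ω, ∫ s : P.parts → X, G (ω.addPoints s) *
          ∏ p : P.parts, u (ω.addPoints s) (s p) ^ (p : Finset (Fin k)).card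
          ∂(Measure.pi fun _ : P.parts => σ) ∂π := by
  have : IsFiniteMeasure (σ.restrict K) := ⟨by simpa using hK.measure_lt_top⟩
  have hM := hπ.compProd_powKernel (ι := Fin k) hK
  let φ : Config X × (Fin k → X) → ℝ := fun q => G q.1 * ∏ i, u q.1 (q.2 i)
  have hφ : Measurable φ := by
    refine (hG.comp measurable_fst).mul (Finset.measurable_prod _ fun i _ => ?_)
    exact hu.comp (measurable_fst.prodMk ((measurable_pi_apply i).comp measurable_snd))
  have hφb : ∀ q, |φ q| ≤ C * D ^ k := by
    intro q
    rw [abs_mul, Finset.abs_prod]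
    refine mul_le_mul (hGb _) ?_ (Finset.prod_nonneg fun _ _ => abs_nonneg _)
      ((abs_nonneg _).trans (hGb q.1))
    refine (Finset.prod_le_prod (fun _ _ => abs_nonneg _) fun i _ => hub q.1 (q.2 i)).trans ?_
    simp
  -- The moment measure is a finite sum of images of finite measures, so the bounded function `φ` is
  -- integrable against it.
  have hfin : IsFiniteMeasure (π ⊗ₘ powKernel hK (Fin k)) := by
    rw [hM]
    refine ⟨?_⟩
    rw [Measure.sum_apply _ MeasurableSet.univ, tsum_fintype]
    exact ENNReal.sum_lt_top.2 fun P _ => measure_lt_top _ _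
  have hφi : Integrable φ (π ⊗ₘ powKernel hK (Fin k)) :=
    Integrable.of_bound hφ.aestronglyMeasurable _ (ae_of_all _ hφb)
  -- Integrating the product over `k` independent copies of `ω|_K` gives the `k`-th power.
  have hinner : ∀ ω : Config X, ∫ x, φ (ω, x) ∂(powKernel hK (Fin k) ω) =
      G ω * (∫ x, u ω x ∂ω.toMeasure) ^ k := by
    intro ω
    have := ω.isFiniteMeasure_restrict hK
    rw [powKernel_apply]
    simp only [φ]
    rw [integral_const_mul, integral_fintype_prod_eq_pow, Fintype.card_fin,
      setIntegral_eq_integral_of_forall_compl_eq_zero (huc ω)]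
  have hψ : ∀ P : Finpartition (Finset.univ : Finset (Fin k)),
      (fun q : Config X × (P.parts → X) => φ (q.1.addPoints q.2, q.2 ∘ P.blockOf)) =
        fun q => G (q.1.addPoints q.2) *
          ∏ p : P.parts, u (q.1.addPoints q.2) (q.2 p) ^ (p : Finset (Fin k)).card := by
    intro P
    ext1 q
    simp only [φ, Function.comp_apply]
    rw [P.prod_blockOf fun p => u (q.1.addPoints q.2) (q.2 p)]
  have hrestr : ∀ P : Finpartition (Finset.univ : Finset (Fin k)),
      π.prod (Measure.pi fun _ : P.parts => σ.restrict K) =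
        (π.prod (Measure.pi fun _ : P.parts => σ)).restrict
          (Set.univ ×ˢ Set.pi Set.univ fun _ => K) := by
    intro P
    rw [← Measure.prod_restrict, Measure.restrict_univ, Measure.restrict_pi_pi]
  -- Blocks are nonempty, so every exponent is positive and a single point outside `K` annihilates
  -- the product. This allows `σ.restrict K` to be replaced by `σ`.
  have hzero : ∀ (P : Finpartition (Finset.univ : Finset (Fin k))),
      ∀ q ∉ (Set.univ ×ˢ Set.pi Set.univ fun _ => K : Set (Config X × (P.parts → X))),
        G (q.1.addPoints q.2) *
          ∏ p : P.parts, u (q.1.addPoints q.2) (q.2 p) ^ (p : Finset (Fin k)).card = 0 := by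
    intro P q hq
    simp only [Set.mem_prod, Set.mem_univ, true_and, Set.mem_univ_pi, not_forall] at hq
    obtain ⟨p, hp⟩ := hq
    rw [Finset.prod_eq_zero (Finset.mem_univ p), mul_zero]
    rw [huc _ _ hp, zero_pow]
    exact (P.nonempty_of_mem_parts p.2).card_pos.ne'
  have hint : ∀ P : Finpartition (Finset.univ : Finset (Fin k)),
      Integrable (fun q : Config X × (P.parts → X) => G (q.1.addPoints q.2) *
        ∏ p : P.parts, u (q.1.addPoints q.2) (q.2 p) ^ (p : Finset (Fin k)).card)
        (π.prod (Measure.pi fun _ : P.parts => σ)) := by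
    intro P
    rw [← integrableOn_iff_integrable_of_support_subset
      fun q hq => not_imp_comm.1 (hzero P q) hq, IntegrableOn, ← hrestr P, ← hψ P]
    exact Integrable.of_bound (hφ.comp (measurable_addPoints_blockOf P)).aestronglyMeasurable _
      (ae_of_all _ fun q => hφb _)
  refine ⟨?_, hint, ?_⟩
  · have h := Integrable.integral_compProd hφi
    simpa [hinner] using h
  · simp_rw [← hinner]
    rw [← Measure.integral_compProd hφi]
    have hsum := hφi
    rw [hM] at hsum ⊢
    rw [integral_sum_measure hsum, tsum_fintype]
    refine Finset.sum_congr rfl fun P _ => ?_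
    rw [integral_map (measurable_addPoints_blockOf P).aemeasurable hφ.aestronglyMeasurable, hψ P,
      hrestr P, setIntegral_eq_integral_of_forall_compl_eq_zero (hzero P), integral_prod _ (hint P)]

end Config

theorem proposition3p2 {X : Type*} [MetricSpace X] [SigmaCompactSpace X]
    [MeasurableSpace X] [BorelSpace X]
    (σ : Measure X) [SigmaFinite σ] [IsFiniteMeasureOnCompacts σ] [NullSingletonClass σ]
    (π : Measure (Config X)) [IsProbabilityMeasure π] (hπ : Config.IsPoisson σ π)
    (F : Config X → ℝ) (hF : Measurable F) (hFb : ∃ C : ℝ, ∀ ω, |F ω| ≤ C)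
    (u : Config X → X → ℝ) (hu : Measurable (Function.uncurry u))
    (hub : ∃ C : ℝ, ∀ ω x, |u ω x| ≤ C)
    (huc : ∃ K : Set X, IsCompact K ∧ ∀ ω, ∀ x ∉ K, u ω x = 0)
    (n : ℕ) :
    -- all the integrals below are absolutely convergent
    (∀ ω, Integrable (u ω) ω.toMeasure ∧ Integrable (u ω) σ) ∧
    Integrable (fun ω => F ω * ((∫ x, u ω x ∂ω.toMeasure) - ∫ x, u ω x ∂σ) ^ n) π ∧
    (∀ c ∈ Finset.range (n + 1), ∀ P : Finpartition (Finset.univ : Finset (Fin (n - c))),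
      Integrable
        (fun q : Config X × (P.parts → X) =>
          Config.epsPlus q.2
            (fun ω => F ω * (∫ x, u ω x ∂σ) ^ c *
              ∏ p : P.parts, u ω (q.2 p) ^ (p : Finset (Fin (n - c))).card) q.1)
        (π.prod (Measure.pi fun _ : P.parts => σ))) ∧
    -- the moment identity
    ∫ ω, F ω * ((∫ x, u ω x ∂ω.toMeasure) - ∫ x, u ω x ∂σ) ^ n ∂π =
      ∑ c ∈ Finset.range (n + 1), (-1 : ℝ) ^ c * (n.choose c : ℝ) *
        ∑ P : Finpartition (Finset.univ : Finset (Fin (n - c))),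
          ∫ ω, (∫ s : P.parts → X,
            Config.epsPlus s
              (fun ω' => F ω' * (∫ x, u ω' x ∂σ) ^ c *
                ∏ p : P.parts, u ω' (s p) ^ (p : Finset (Fin (n - c))).card) ω
            ∂(Measure.pi fun _ : P.parts => σ)) ∂π := by
  obtain ⟨C, hC⟩ := hFb
  obtain ⟨D, hD⟩ := hub
  obtain ⟨K, hK, huK⟩ := huc
  have hum : ∀ ω, Measurable (u ω) := fun ω => hu.comp measurable_prodMk_left
  have hbm : Measurable fun ω => ∫ x, u ω x ∂σ :=
    (hu.stronglyMeasurable.integral_prod_right (ν := σ)).measurable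
  have hbb : ∀ ω, |∫ x, u ω x ∂σ| ≤ D * σ.real K := fun ω => by
    rw [← setIntegral_eq_integral_of_forall_compl_eq_zero (huK ω)]
    exact norm_setIntegral_le_of_norm_le_const hK.measure_lt_top fun x _ =>
      (Real.norm_eq_abs _).trans_le (hD ω x)
  have hGb : ∀ c ω, |F ω * (∫ x, u ω x ∂σ) ^ c| ≤ C * (D * σ.real K) ^ c := fun c ω => by
    rw [abs_mul, abs_pow]
    exact mul_le_mul (hC ω) (pow_le_pow_left₀ (abs_nonneg _) (hbb ω) c)
      (pow_nonneg (abs_nonneg _) c) ((abs_nonneg _).trans (hC ω))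
  have hGm : ∀ c : ℕ, Measurable fun ω => F ω * (∫ x, u ω x ∂σ) ^ c := fun c =>
    hF.mul (hbm.pow_const c)
  -- The random compensator belongs to the weight `G`, so it too is evaluated at the enlarged
  -- configuration.
  have key := fun c =>
    hπ.integral_mul_integral_toMeasure_pow (hGm c) (hGb c) hu hD hK huK (n - c)
  have hexp : ∀ ω, F ω * ((∫ x, u ω x ∂ω.toMeasure) - ∫ x, u ω x ∂σ) ^ n =
      ∑ c ∈ Finset.range (n + 1), (-1 : ℝ) ^ c * (n.choose c : ℝ) *
        (F ω * (∫ x, u ω x ∂σ) ^ c * (∫ x, u ω x ∂ω.toMeasure) ^ (n - c)) := fun ω => by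
    rw [sub_eq_neg_add, add_pow, Finset.mul_sum]
    refine Finset.sum_congr rfl fun c _ => ?_
    rw [neg_pow]; ring
  refine ⟨fun ω => ⟨?_, ?_⟩, ?_, fun c _ P => (key c).2.1 P, ?_⟩
  · exact Config.integrable_of_bounded_of_support (hum ω) (hD ω) (ω.toMeasure_lt_top hK) (huK ω)
  · exact Config.integrable_of_bounded_of_support (hum ω) (hD ω) hK.measure_lt_top (huK ω)
  · simp_rw [hexp]
    exact integrable_finsetSum _ fun c _ => (key c).1.const_mul _
  · simp_rw [hexp]
    rw [integral_finsetSum _ fun c _ => (key c).1.const_mul _]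
    refine Finset.sum_congr rfl fun c _ => ?_
    rw [integral_const_mul]
    exact congrArg _ (key c).2.2
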